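/- Let a finite group $G$ act transitively on a finite set $\Omega$. An orbital is an orbit of $G$ on $\Omega\times\Omega$, and a generalized orbital graph of the action is a simple undirected graph with vertex set $\Omega$ in which $x,y$ are adjacent if and only if $(x,y)\in\mathcal O$, where $\mathcal O$ is a symmetric union of orbitals that avoids the diagonal. A graph is hamiltonian if it has a cycle through all of its vertices. For $\varepsilon\in\{+1,-1\}$ and $d \ge 1$ let $Q^{\varepsilon}$ be the nondegenerate quadratic form on $\mathrm{GF}(2)^{2d}$ of type $\varepsilon$, that is, $Q^{+}=\sum_{i=0}^{d-1}x_iy_i$ and $Q^{-}=x_0^2+x_0y_0+y_0^2+\sum_{i=1}^{d-1}x_iy_i$, and let $P\Omega^{\varepsilon}(2d,2)$ be the commutator subgroup of the isometry group of $Q^{\varepsilon}$ (over $\mathrm{GF}(2)$ there are no nontrivial scalars to factor out). It acts on the singular $1$-spaces, which are the one-dimensional subspaces on which $Q^{\varepsilon}$ vanishes. **Proposition 5.1.** In each of the following actions, every generalized orbital graph with at least one edge is hamiltonian. 1. The action of $P\Omega^{\varepsilon}(2d,2)$ on the singular $1$-spaces, where $\varepsilon\in\{+1,-1\}$ and $p=2^d-\varepsilon$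 and $q=2^{d-1}+\varepsilon$ are primes with $p>q$. 2. The action of degree $77$ of the Mathieu group $M_{22}$, on the hexads (blocks) of the Steiner system $S(3,6,22)$. 3. The action of the alternating group $A_7$ on the $3$-element subsets of $\{1,\dots,7\}$. -/

import Mathlib

/-! ### Generalized orbital graphs -/

/-- `X` is a generalized orbital graph of the action of `G` on `Ω`: there is a set `𝒪` of orbitals,
that is, of orbits of `G` on `Ω × Ω`, such that `x` and `y` are adjacent in `X` exactly when `(x, y)`
lies in one of the orbitals in `𝒪`. As a `SimpleGraph` is symmetric and loopless, the union of `𝒪`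
is then symmetric and avoids the diagonal. -/
def IsGeneralizedOrbitalGraph (G : Type*) {Ω : Type*} [Group G] [MulAction G Ω]
    (X : SimpleGraph Ω) : Prop :=
  ∃ 𝒪 : Set (Set (Ω × Ω)),
    (∀ S ∈ 𝒪, ∃ z : Ω × Ω, S = MulAction.orbit G z) ∧
    ∀ x y : Ω, X.Adj x y ↔ (x, y) ∈ ⋃₀ 𝒪

/-! ### The orthogonal groups over the field with two elements -/

/-- The vector space of dimension `2d` over `GF(2)`, with coordinates
`x₀, …, x_{d-1}, y₀, …, y_{d-1}`. -/
abbrev OrthSpace (d : ℕ) : Type := (Fin d → ZMod 2) × (Fin d → ZMod 2)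

namespace OrthSpace

/-- The coordinate `xᵢ`. -/
def xCoord (d : ℕ) (i : Fin d) : OrthSpace d →ₗ[ZMod 2] ZMod 2 :=
  (LinearMap.proj i).comp (LinearMap.fst (ZMod 2) (Fin d → ZMod 2) (Fin d → ZMod 2))

/-- The coordinate `yᵢ`. -/
def yCoord (d : ℕ) (i : Fin d) : OrthSpace d →ₗ[ZMod 2] ZMod 2 :=
  (LinearMap.proj i).comp (LinearMap.snd (ZMod 2) (Fin d → ZMod 2) (Fin d → ZMod 2))

/-- The quadratic form of plus type, `∑ i, xᵢ yᵢ`. -/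
def plusForm (d : ℕ) : QuadraticForm (ZMod 2) (OrthSpace d) :=
  ∑ i : Fin d, QuadraticMap.linMulLin (xCoord d i) (yCoord d i)

/-- The quadratic form of minus type, `x₀² + x₀ y₀ + y₀² + ∑ i ≥ 1, xᵢ yᵢ`
(for `d ≥ 1`; the second sum below has the one term `i = 0`). -/
def minusForm (d : ℕ) : QuadraticForm (ZMod 2) (OrthSpace d) :=
  plusForm d + ∑ i ∈ Finset.univ.filter (fun i : Fin d => i.val = 0),
    (QuadraticMap.linMulLin (xCoord d i) (xCoord d i) +
      QuadraticMap.linMulLin (yCoord d i) (yCoord d i))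

end OrthSpace

section Orthogonal

variable {V : Type*} [AddCommGroup V] [Module (ZMod 2) V]

/-- The full orthogonal group `O(V, Q)`: all linear isometries of `Q`. -/
def isometryGroup (Q : QuadraticForm (ZMod 2) V) : Subgroup (V ≃ₗ[ZMod 2] V) where
  carrier := {g | ∀ v, Q (g v) = Q v}
  mul_mem' := fun {a b} ha hb v => by
    rw [LinearEquiv.mul_apply, ha, hb]
  one_mem' := fun _ => rfl
  inv_mem' := fun {a} ha v => by
    have h := ha (a⁻¹ v)
    rw [← LinearEquiv.mul_apply, mul_inv_cancel] at h
    exact h.symm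

/-- The group `PΩ(V, Q)` over `GF(2)`: the commutator subgroup `Ω(V, Q)` of the orthogonal group.
Over `GF(2)` the only nonzero scalar is `1`, so passing to the projective group changes nothing. -/
def POmega (Q : QuadraticForm (ZMod 2) V) : Subgroup (isometryGroup Q) :=
  commutator (isometryGroup Q)

/-- The singular `1`-spaces of the quadratic space `(V, Q)`: the one-dimensional subspaces
on which `Q` vanishes. -/
def SingularOneSpace (Q : QuadraticForm (ZMod 2) V) : Type _ :=
  {W : Submodule (ZMod 2) V // Module.finrank (ZMod 2) W = 1 ∧ ∀ w ∈ W, Q w = 0}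

namespace SingularOneSpace

variable (Q : QuadraticForm (ZMod 2) V)

noncomputable instance : DecidableEq (SingularOneSpace Q) := Classical.decEq _

noncomputable instance [Finite V] : Fintype (SingularOneSpace Q) :=
  haveI : Finite (SingularOneSpace Q) := inferInstanceAs (Finite (Subtype _))
  Fintype.ofFinite _

/-- Isometries permute the singular `1`-spaces: `g` sends `W` to its image `g(W)`. The group
`POmega Q` acts by restriction of this action. -/
instance : MulAction (isometryGroup Q) (SingularOneSpace Q) where
  smul g W := ⟨W.1.map (g.1 : V →ₗ[ZMod 2] V), by
    refine ⟨?_, ?_⟩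
    · rw [LinearEquiv.finrank_map_eq]
      exact W.2.1
    · rintro _ ⟨w, hw, rfl⟩
      exact (g.2 w).trans (W.2.2 w hw)⟩
  one_smul W := Subtype.ext (Submodule.map_id W.1)
  mul_smul g h W := Subtype.ext
    (Submodule.map_comp (h.1 : V →ₗ[ZMod 2] V) (g.1 : V →ₗ[ZMod 2] V) W.1)

end SingularOneSpace

end Orthogonal

/-! ### The Mathieu group `M₂₂` and the 77 hexads -/

namespace Mathieu

open scoped Pointwise

/-- The 24 points: the projective line over `GF(23)`, with `none` as the point `∞`. -/
abbrev Point : Type := Option (ZMod 23)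

/-- The set consisting of `∞` and of all `n + i` with `n` a nonsquare modulo `23`. -/
def checkSet (i : ZMod 23) : Finset Point :=
  insert none (Finset.univ.filter fun z : Point =>
    ∃ n ∈ ({5, 7, 10, 11, 14, 15, 17, 19, 20, 21, 22} : Finset (ZMod 23)), z = some (n + i))

/-- The extended binary Golay code, as the extended quadratic residue code of length `24`, with
words of `GF(2)^24` identified with subsets of the set of points. It is given by its parity checks:
a set is a codeword when it meets each set `checkSet i` in an even number of points. (The code is
self-dual, and it is also the code spanned by the words `checkSet i`.) -/
def golayCode : Set (Finset Point) :=
  {s | ∀ i : ZMod 23, Even (s ∩ checkSet i).card}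

/-- The Mathieu group `M₂₄`: the permutations of the 24 points that preserve the Golay code. -/
def M24 : Subgroup (Equiv.Perm Point) :=
  MulAction.stabilizer (Equiv.Perm Point) golayCode

/-- The Mathieu group `M₂₂`: the pointwise stabilizer in `M₂₄` of the two points `∞` and `0`. -/
def M22 : Subgroup (Equiv.Perm Point) :=
  M24 ⊓ fixingSubgroup (Equiv.Perm Point) ({none, some 0} : Set Point)

/-- The hexads, which are the 77 blocks of the Steiner system `S(3,6,22)` on the points other than
`∞` and `0`: the 6-sets of such points that together with `∞` and `0` form an octad
(a codeword of weight 8) of the Golay code. -/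
def Hexad : Type :=
  {h : Finset Point // none ∉ h ∧ some 0 ∉ h ∧ h.card = 6 ∧
    insert none (insert (some 0) h) ∈ golayCode}

instance : DecidableEq Hexad := inferInstanceAs (DecidableEq (Subtype _))

noncomputable instance : Fintype Hexad :=
  haveI : Finite Hexad := inferInstanceAs (Finite (Subtype _))
  Fintype.ofFinite _

/-- `M₂₂` permutes the hexads: `σ` sends `h` to its image `σ(h)`. -/
instance : MulAction M22 Hexad where
  smul σ h := ⟨σ.1 • h.1, by
    obtain ⟨⟨σ, hs⟩, ⟨h, h1, h2, h3, h4⟩⟩ := σ, h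
    obtain ⟨hσ, hfix⟩ := Subgroup.mem_inf.mp hs
    rw [mem_fixingSubgroup_iff] at hfix
    change none ∉ σ • h ∧ some 0 ∉ σ • h ∧ (σ • h).card = 6 ∧
      insert none (insert (some 0) (σ • h)) ∈ golayCode
    have e1 : σ • (none : Point) = none := hfix none (by simp)
    have e2 : σ • (some 0 : Point) = some 0 := hfix (some 0) (by simp)
    refine ⟨?_, ?_, ?_, ?_⟩
    · intro hm
      rw [← e1, Finset.smul_mem_smul_finset_iff] at hm
      exact h1 hm
    · intro hm
      rw [← e2, Finset.smul_mem_smul_finset_iff] at hm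
      exact h2 hm
    · rw [Finset.card_smul_finset]
      exact h3
    · have h5 : σ • insert (none : Point) (insert (some 0) h) ∈ σ • golayCode :=
        Set.smul_mem_smul_set h4
      rw [show σ • golayCode = golayCode from MulAction.mem_stabilizer_iff.mp hσ, Finset.smul_finset_insert,
        Finset.smul_finset_insert, e1, e2] at h5
      exact h5⟩
  one_smul h := Subtype.ext (one_smul (Equiv.Perm Point) h.1)
  mul_smul σ τ h := Subtype.ext (mul_smul σ.1 τ.1 h.1)

end Mathieu

/-! In each action the group is transitive on the pairs of distinct points with a given invariant:
the value of the polar form on two singular vectors, or the size of the intersection of two hexads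
or of two triples. So a generalized orbital graph with one edge contains all pairs having the
invariant of that edge, and it suffices to find a Hamilton cycle in each of these spanning
subgraphs.

For the orthogonal groups the cycle comes from `isHamiltonian_of_card_neighborFinset`, whose
hypotheses are a minimum degree `k`, two common neighbours for any two vertices, and independent
sets of size at most `3k + 1 - n`. A longest path yields a cycle of length at least `2k` or one
through the whole path, and a longest cycle of length at least `2k` misses no vertex. With `x = 2^d`
the Gauss sum of the form is `x` or `-x`, and character sums give `n` near `x²/2`, `k` near `x²/4`,
and independent sets of size at most `x + 2`, well below `3k - n`, which is near `x²/4`. The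
arithmetic conditions are used only to get `d ≥ 3` for plus type and `d ≥ 4` for minus type.
Transitivity (`GaussSumSmall.exists_POmega_map_eq`) comes from products of transvections, corrected
by one more transvection so as to lie in the commutator subgroup.

For hexads and triples the cycles are explicit lists that are checked by evaluation. Transitivity
for `A₇` is a matching of fibres with a correction of the sign. For `M₂₂` the Golay code is put in
echelon form, which enumerates the hexads, and explicit permutations are shown to reach all hexads,
and from a base hexad all hexads in a given relation to it. -/

namespace SimpleGraph

/-! ### Paths and cycles as lists, and exchange moves on them. -/

variable {V : Type*} (G : SimpleGraph V)

/-- A duplicate-free list of vertices in which consecutive vertices are adjacent. -/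
def IsPathList (l : List V) : Prop :=
  l.Nodup ∧ l.IsChain G.Adj

/-- A duplicate-free list of vertices in which consecutive vertices are adjacent, and so are the
last and the first vertex. -/
def IsCycleList (l : List V) : Prop :=
  l.Nodup ∧ l.IsChain G.Adj ∧ ∀ a ∈ l.getLast?, ∀ b ∈ l.head?, G.Adj a b

variable {G}

theorem IsPathList.reverse {l : List V} (h : G.IsPathList l) : G.IsPathList l.reverse := by
  refine ⟨List.nodup_reverse.2 h.1, ?_⟩
  rw [List.isChain_reverse]
  exact h.2.imp fun _ _ h => h.symm

theorem IsPathList.cons {l : List V} {x y : V} (h : G.IsPathList (y :: l)) (hx : x ∉ y :: l)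
    (hxy : G.Adj x y) : G.IsPathList (x :: y :: l) :=
  ⟨List.nodup_cons.2 ⟨hx, h.1⟩, List.isChain_cons_cons.2 ⟨hxy, h.2⟩⟩

theorem IsCycleList.isPathList {l : List V} (h : G.IsCycleList l) : G.IsPathList l :=
  ⟨h.1, h.2.1⟩

theorem IsCycleList.append_comm {l₁ l₂ : List V} (h : G.IsCycleList (l₁ ++ l₂)) :
    G.IsCycleList (l₂ ++ l₁) := by
  rcases eq_or_ne l₁ [] with rfl | h1
  · simpa using h
  rcases eq_or_ne l₂ [] with rfl | h2
  · simpa using h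
  obtain ⟨hn, hc, hl⟩ := h
  refine ⟨List.nodup_append_comm.1 hn, ?_, ?_⟩
  · rw [List.isChain_append] at hc ⊢
    refine ⟨hc.2.1, hc.1, ?_⟩
    rwa [List.getLast?_append_of_ne_nil _ h2, List.head?_append_of_ne_nil _ h1] at hl
  · rw [List.isChain_append] at hc
    rw [List.getLast?_append_of_ne_nil _ h1, List.head?_append_of_ne_nil _ h2]
    exact hc.2.2

theorem isHamiltonian_of_isCycleList [Fintype V] [DecidableEq V] {l : List V}
    (h : G.IsCycleList l) (h3 : 3 ≤ l.length) (hcard : l.length = Fintype.card V) :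
    G.IsHamiltonian := by
  intro _
  have hne : l ≠ [] := by rintro rfl; simp at h3
  obtain ⟨hn, hc, hl⟩ := h
  have hadj : G.Adj (l.getLast hne) (l.head hne) :=
    hl _ (List.getLast?_eq_some_getLast hne) _ (List.head?_eq_some_head hne)
  have hp : (Walk.ofSupport l hne hc).support = l := Walk.support_ofSupport hne hc
  have hlen : (Walk.ofSupport l hne hc).length + 1 = l.length := by
    rw [← Walk.length_support, hp]
  have hpath : (Walk.ofSupport l hne hc).IsPath := Walk.IsPath.mk' (by rw [hp]; exact hn)
  refine ⟨_, Walk.cons hadj (Walk.ofSupport l hne hc), ?_⟩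
  rw [Walk.isHamiltonianCycle_iff_isCycle_and_length_eq]
  refine ⟨(Walk.cons_isCycle_iff _ _).2 ⟨hpath, fun hm => ?_⟩, ?_⟩
  -- If the closing edge lay on the path, the path would be that edge alone, against `3 ≤ l.length`.
  · have := hpath.length_eq_one_of_mem_edges (by rwa [Sym2.eq_swap])
    omega
  · rw [Walk.length_cons, hlen, hcard]

/-- A vertex off a cycle that is adjacent to a vertex of the cycle gives a longer path. -/
theorem IsCycleList.exists_isPathList {l : List V} (h : G.IsCycleList l) {x y : V} (hx : x ∉ l)
    (hy : y ∈ l) (hxy : G.Adj x y) : ∃ l', G.IsPathList l' ∧ l'.length = l.length + 1 := by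
  obtain ⟨A, B, rfl⟩ := List.append_of_mem hy
  have h' := h.append_comm
  refine ⟨x :: ((y :: B) ++ A), ?_, by simp; omega⟩
  exact h'.isPathList.cons (by simpa [or_comm, or_assoc, or_left_comm] using hx) hxy

/-- If the two ends of a path are adjacent to vertices of the path in a crossing way, then
leaving out the part between these vertices gives a cycle. -/
theorem IsPathList.crossing {A M B : List V} (h : G.IsPathList (A ++ (M ++ B)))
    (hA : A ≠ []) (hB : B ≠ []) (h1 : G.Adj (A.getLast hA) (B.getLast hB))
    (h2 : G.Adj (A.head hA) (B.head hB)) : G.IsCycleList (A ++ B.reverse) := by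
  obtain ⟨hn, hc⟩ := h
  have hsub : (A ++ B).Sublist (A ++ (M ++ B)) :=
    List.Sublist.append_left (List.sublist_append_right M B) A
  have hn' : (A ++ B).Nodup := hn.sublist hsub
  rw [List.isChain_append] at hc
  have hcA := hc.1
  have hcB := (List.isChain_append.1 hc.2.1).2.1
  refine ⟨?_, ?_, ?_⟩
  · exact ((List.reverse_perm B).append_left A).nodup_iff.2 hn'
  · rw [List.isChain_append]
    refine ⟨hcA, ?_, ?_⟩
    · rw [List.isChain_reverse]
      exact hcB.imp fun _ _ h => h.symm
    · rw [List.getLast?_eq_some_getLast hA, List.head?_reverse, List.getLast?_eq_some_getLast hB]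
      simpa using h1
  · rw [List.getLast?_append_of_ne_nil _ (by simpa using hB), List.head?_append_of_ne_nil _ hA,
      List.getLast?_reverse, List.head?_eq_some_head hB, List.head?_eq_some_head hA]
    simpa using h2.symm

/-- If a vertex off a cycle is adjacent to two vertices of the cycle whose successors are adjacent,
then there is a longer cycle. -/
theorem IsCycleList.insert_vertex {A B : List V} (h : G.IsCycleList (A ++ B)) (hA : A ≠ []) (hB : B ≠ [])
    {x : V} (hx : x ∉ A ++ B) (h1 : G.Adj x (A.getLast hA)) (h2 : G.Adj x (B.getLast hB))
    (h3 : G.Adj (A.head hA) (B.head hB)) : G.IsCycleList (A ++ x :: B.reverse) := by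
  obtain ⟨hn, hc, -⟩ := h
  rw [List.isChain_append] at hc
  have hp : (A ++ x :: B.reverse).Perm (x :: (A ++ B)) :=
    List.perm_middle.trans (((List.reverse_perm B).append_left A).cons x)
  refine ⟨hp.nodup_iff.2 (List.nodup_cons.2 ⟨hx, hn⟩), ?_, ?_⟩
  · rw [List.isChain_append]
    refine ⟨hc.1, ?_, ?_⟩
    · rw [List.isChain_cons]
      refine ⟨?_, ?_⟩
      · rw [List.head?_reverse, List.getLast?_eq_some_getLast hB]
        simpa using h2
      · rw [List.isChain_reverse]
        exact hc.2.1.imp fun _ _ h => h.symm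
    · rw [List.getLast?_eq_some_getLast hA]
      simpa using h1.symm
  · have e : A ++ x :: B.reverse = (A ++ [x]) ++ B.reverse := by simp
    rw [e, List.getLast?_append_of_ne_nil _ (by simpa using hB), ← e,
      List.head?_append_of_ne_nil _ hA,
      List.getLast?_reverse, List.head?_eq_some_head hB, List.head?_eq_some_head hA]
    simpa using h3.symm

/-- If a vertex off a cycle is adjacent to two consecutive vertices of the cycle, then there is a
longer cycle. -/
theorem IsCycleList.append_singleton {A : List V} (h : G.IsCycleList A) (hA : A ≠ []) {x : V}
    (hx : x ∉ A) (h1 : G.Adj x (A.getLast hA)) (h2 : G.Adj x (A.head hA)) :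
    G.IsCycleList (A ++ [x]) := by
  refine ⟨?_, ?_, ?_⟩
  · exact (List.perm_append_singleton x A).nodup_iff.2 (List.nodup_cons.2 ⟨hx, h.1⟩)
  · rw [List.isChain_append]
    refine ⟨h.2.1, by simp, ?_⟩
    rw [List.getLast?_eq_some_getLast hA]
    simpa using h1.symm
  · rw [List.getLast?_append_of_ne_nil _ (by simp), List.head?_append_of_ne_nil _ hA,
      List.head?_eq_some_head hA]
    simpa using h2

theorem exists_maximal_length [Fintype V] {p : List V → Prop} (hp : ∀ l, p l → l.Nodup)
    {l₀ : List V} (h₀ : p l₀) : ∃ l, p l ∧ ∀ l', p l' → l'.length ≤ l.length := by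
  classical
  have hb : ∀ l, p l → l.length ≤ Fintype.card V := fun l hl => (hp l hl).length_le_card
  have hex : ∃ k, ∃ l, p l ∧ Fintype.card V - l.length = k := ⟨_, l₀, h₀, rfl⟩
  obtain ⟨l, hl, hk⟩ := Nat.find_spec hex
  refine ⟨l, hl, fun l' hl' => ?_⟩
  have := Nat.find_min' hex ⟨l', hl', rfl⟩
  have h1 := hb l hl
  have h2 := hb l' hl'
  omega

end SimpleGraph

/-! ### A degree condition for hamiltonicity, by longest paths and longest cycles. -/

namespace SimpleGraph

variable {V : Type*} {G : SimpleGraph V}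

/-- The vertex after the vertex number `i` on a cycle. -/
def cycleSucc (l : List V) (i : Fin l.length) : V :=
  l[(i.1 + 1) % l.length]'(Nat.mod_lt _ (i.pos))

theorem cycleSucc_injective {l : List V} (hl : l.Nodup) : Function.Injective (cycleSucc l) := by
  intro i j hij
  have hm : 0 < l.length := i.pos
  rw [cycleSucc, cycleSucc, hl.getElem_inj_iff] at hij
  have h1 : i.1 ≡ j.1 [MOD l.length] := Nat.ModEq.add_right_cancel' 1 hij
  exact Fin.ext (Nat.ModEq.eq_of_lt_of_lt h1 i.2 j.2)

/-- The successors on a longest cycle of the neighbours of a vertex off the cycle are not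
adjacent to that vertex. -/
theorem IsCycleList.not_adj_cycleSucc {l : List V} (h : G.IsCycleList l)
    (hmax : ∀ l', G.IsCycleList l' → l'.length ≤ l.length) {x : V} (hx : x ∉ l)
    {i : Fin l.length} (hi : G.Adj x l[i]) : ¬ G.Adj x (cycleSucc l i) := by
  intro hs
  -- Rotated in this way, the cycle starts at the successor of `l[i]` and ends at `l[i]`. If `x` is
  -- adjacent to both, it can be inserted between them.
  have hc : G.IsCycleList (l.drop (i + 1) ++ l.take (i + 1)) := by
    apply IsCycleList.append_comm
    rwa [List.take_append_drop]
  have hne : l.take (i + 1) ≠ [] := by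
    rw [Ne, List.take_eq_nil_iff]
    rintro (h | h)
    · omega
    · have := i.2; simp [h] at this
  have hx' : x ∉ l.drop (i + 1) ++ l.take (i + 1) := by
    rw [List.mem_append]
    rintro (h | h)
    · exact hx (List.mem_of_mem_drop h)
    · exact hx (List.mem_of_mem_take h)
  have hA : l.drop (i + 1) ++ l.take (i + 1) ≠ [] := by simp [hne]
  have := hmax _ (hc.append_singleton hA hx' ?_ ?_)
  · simp only [List.length_append, List.length_drop, List.length_take, List.length_singleton] at this
    have := i.2
    omega
  · rw [List.getLast_append_of_ne_nil _ hne, List.getLast_take]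
    simpa [List.getElem?_eq_getElem i.2] using hi
  · have hi2 := i.2
    rcases Nat.lt_or_ge (i + 1) l.length with h1 | h1
    · have hd : l.drop (i + 1) ≠ [] := by simpa using h1
      rw [List.head_append_of_ne_nil hd, List.head_drop]
      simpa [cycleSucc, Nat.mod_eq_of_lt h1] using hs
    · have h2 : i.1 + 1 = l.length := by omega
      have : l.drop (i + 1) ++ l.take (i + 1) = l := by simp [h2]
      simp only [this]
      rw [List.head_eq_getElem]
      simpa [cycleSucc, h2] using hs

/-- The successors on a longest cycle of two neighbours of a vertex off the cycle are not
adjacent. -/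
theorem IsCycleList.not_adj_cycleSucc_cycleSucc {l : List V} (h : G.IsCycleList l)
    (hmax : ∀ l', G.IsCycleList l' → l'.length ≤ l.length) {x : V} (hx : x ∉ l)
    {i j : Fin l.length} (hij : i < j) (hi : G.Adj x l[i]) (hj : G.Adj x l[j]) :
    ¬ G.Adj (cycleSucc l i) (cycleSucc l j) := by
  intro hs
  have hi2 := i.2
  have hj2 := j.2
  have hij' : i.1 < j.1 := hij
  -- `A` runs from the successor of `l[i]` to `l[j]`, and `B` from the successor of `l[j]` round to
  -- `l[i]`. Then `A`, `x`, reversed `B` closes up to a longer cycle.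
  set A := (l.drop (i + 1)).take (j - i) with hAdef
  set B := l.drop (j + 1) ++ l.take (i + 1) with hBdef
  have hdd : (l.drop (i + 1)).drop (j - i) = l.drop (j + 1) := by
    rw [List.drop_drop]; congr 1; omega
  have hAB : A ++ B = l.drop (i + 1) ++ l.take (i + 1) := by
    rw [hAdef, hBdef, ← List.append_assoc, ← hdd, List.take_append_drop]
  have hc : G.IsCycleList (A ++ B) := by
    rw [hAB]
    apply IsCycleList.append_comm
    rwa [List.take_append_drop]
  have hne : l.take (i + 1) ≠ [] := by
    rw [Ne, List.take_eq_nil_iff]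
    rintro (h | h)
    · omega
    · simp [h] at hi2
  have hx' : x ∉ A ++ B := by
    rw [hAB, List.mem_append]
    rintro (h | h)
    · exact hx (List.mem_of_mem_drop h)
    · exact hx (List.mem_of_mem_take h)
  have hA : A ≠ [] := by
    rw [hAdef, Ne, List.take_eq_nil_iff, List.drop_eq_nil_iff]
    omega
  have hB : B ≠ [] := by simp [hBdef, hne]
  have hlen : (A ++ B).length = l.length := by
    rw [hAB]; simp only [List.length_append, List.length_drop, List.length_take]; omega
  have := hmax _ (hc.insert_vertex hA hB hx' ?_ ?_ ?_)
  · simp only [List.length_append, List.length_cons, List.length_reverse] at this hlen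
    omega
  · simp only [hAdef]
    rw [List.getLast_take, List.getElem?_drop]
    have e : i.1 + 1 + (j.1 - i.1 - 1) = j.1 := by omega
    simpa [e, List.getElem?_eq_getElem hj2] using hj
  · simp only [hBdef]
    rw [List.getLast_append_of_ne_nil _ hne, List.getLast_take]
    simpa [List.getElem?_eq_getElem hi2] using hi
  · have e1 : A.head hA = cycleSucc l i := by
      simp only [hAdef]
      rw [List.head_take, List.head_drop]
      simp [cycleSucc, Nat.mod_eq_of_lt (show i.1 + 1 < l.length by omega)]
    have e2 : B.head hB = cycleSucc l j := by
      simp only [hBdef]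
      rcases Nat.lt_or_ge (j + 1) l.length with h1 | h1
      · have hd : l.drop (j + 1) ≠ [] := by simpa using h1
        rw [List.head_append_of_ne_nil hd, List.head_drop]
        simp [cycleSucc, Nat.mod_eq_of_lt h1]
      · have h2 : j.1 + 1 = l.length := by omega
        have : l.drop (j + 1) = [] := by simp [h2]
        simp only [this, List.nil_append]
        rw [List.head_take, List.head_eq_getElem]
        simp [cycleSucc, h2]
    rwa [e1, e2]

/-- A longest cycle of a graph contains all vertices if it leaves out few vertices and all
independent sets are small. -/
theorem IsCycleList.mem_of_maximal [Fintype V] [DecidableEq V] [DecidableRel G.Adj] {k : ℕ}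
    (hk : ∀ v, k ≤ (G.neighborFinset v).card)
    (hind : ∀ s : Finset V, (∀ a ∈ s, ∀ b ∈ s, ¬ G.Adj a b) →
      s.card + Fintype.card V ≤ 3 * k + 1)
    {l : List V} (h : G.IsCycleList l) (hmax : ∀ l', G.IsCycleList l' → l'.length ≤ l.length)
    (h2 : 2 * k ≤ l.length) (x : V) : x ∈ l := by
  by_contra hx
  set I : Finset (Fin l.length) := Finset.univ.filter fun i => G.Adj x l[i] with hI
  -- At most `n - l.length - 1` neighbours of `x` lie off the cycle.
  have hIcard : k + l.length + 1 ≤ I.card + Fintype.card V := by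
    have hsub : G.neighborFinset x ⊆
        I.image (fun i => l[i]) ∪ (insert x l.toFinset)ᶜ := by
      intro y hy
      rw [mem_neighborFinset] at hy
      by_cases hyl : y ∈ l
      · obtain ⟨i, hi, rfl⟩ := List.getElem_of_mem hyl
        refine Finset.mem_union_left _ (Finset.mem_image.2 ⟨⟨i, hi⟩, ?_, rfl⟩)
        simpa [hI] using hy
      · refine Finset.mem_union_right _ ?_
        simp only [Finset.mem_compl, Finset.mem_insert, List.mem_toFinset, not_or]
        exact ⟨hy.ne', hyl⟩
    have h1 := (Finset.card_le_card hsub).trans (Finset.card_union_le _ _)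
    have h3 : (I.image (fun i => l[i])).card ≤ I.card := Finset.card_image_le
    have h4 : (insert x l.toFinset).card = l.length + 1 := by
      rw [Finset.card_insert_of_notMem (by simpa using hx), List.toFinset_card_of_nodup h.1]
    have h5 := Finset.card_compl_add_card (insert x l.toFinset)
    have := hk x
    omega
  have hxs : x ∉ I.image (cycleSucc l) := by
    intro hm
    obtain ⟨i, -, hi⟩ := Finset.mem_image.1 hm
    exact hx (hi ▸ List.getElem_mem _)
  -- `x` and the successors of its neighbours on the cycle form an independent set of size at least
  -- `k + l.length + 2 - n`. The bound `3k + 1 - n` then forces `l.length < 2k`.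
  have hS := hind (insert x (I.image (cycleSucc l))) ?_
  · rw [Finset.card_insert_of_notMem hxs,
      Finset.card_image_of_injective _ (cycleSucc_injective h.1)] at hS
    omega
  · have key1 : ∀ i ∈ I, ¬ G.Adj x (cycleSucc l i) := fun i hi =>
      h.not_adj_cycleSucc hmax hx (by simpa [hI] using hi)
    have key2 : ∀ i ∈ I, ∀ j ∈ I, ¬ G.Adj (cycleSucc l i) (cycleSucc l j) := by
      intro i hi j hj
      have hi' : G.Adj x l[i] := by simpa [hI] using hi
      have hj' : G.Adj x l[j] := by simpa [hI] using hj
      rcases lt_trichotomy i j with hij | rfl | hij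
      · exact h.not_adj_cycleSucc_cycleSucc hmax hx hij hi' hj'
      · exact G.irrefl
      · exact fun hs => h.not_adj_cycleSucc_cycleSucc hmax hx hij hj' hi' hs.symm
    intro a ha b hb
    rw [Finset.mem_insert, Finset.mem_image] at ha hb
    rcases ha with rfl | ⟨i, hi, rfl⟩ <;> rcases hb with rfl | ⟨j, hj, rfl⟩
    · exact G.irrefl
    · exact key1 j hj
    · exact fun hs => key1 i hi hs.symm
    · exact key2 i hi j hj

/-- A longest path whose ends have at least two common neighbours gives a long cycle. -/
theorem IsPathList.exists_isCycleList [Fintype V] [DecidableEq V] [DecidableRel G.Adj] {k : ℕ}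
    (hk : ∀ v, k ≤ (G.neighborFinset v).card)
    (hcn : ∀ x y, x ≠ y → 2 ≤ (G.neighborFinset x ∩ G.neighborFinset y).card)
    {l : List V} (h : G.IsPathList l) (hmax : ∀ l', G.IsPathList l' → l'.length ≤ l.length)
    (hl : 2 ≤ l.length) :
    ∃ c, G.IsCycleList c ∧ c ≠ [] ∧ (2 * k ≤ c.length ∨ c.length = l.length) := by
  have hne : l ≠ [] := by rintro rfl; simp at hl
  set m := l.length with hm
  set a := l.head hne with ha
  set b := l.getLast hne with hb
  have ha0 : l[0] = a := by rw [ha, List.head_eq_getElem]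
  have hbm : l[m - 1] = b := by rw [hb, List.getLast_eq_getElem]
  have hab : a ≠ b := by
    rw [← ha0, ← hbm, Ne, h.1.getElem_inj_iff]
    omega
  -- A neighbour of an end that is off the path would prolong the path.
  have hamem : ∀ y, G.Adj a y → y ∈ l := by
    intro y hy
    by_contra hyl
    obtain ⟨a', t, rfl⟩ := List.exists_cons_of_ne_nil hne
    have := hmax _ (h.cons hyl (by simpa [ha] using hy.symm))
    simp [hm] at this
  have hbmem : ∀ y, G.Adj b y → y ∈ l := by
    intro y hy
    by_contra hyl
    have hr := h.reverse
    obtain ⟨b', t, hbt⟩ := List.exists_cons_of_ne_nil (List.reverse_ne_nil_iff.2 hne)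
    have hbb : b' = b := by
      have h1 : l.reverse.head? = some b' := by rw [hbt]; rfl
      rw [List.head?_reverse, List.getLast?_eq_some_getLast hne] at h1
      exact (Option.some_injective _ h1).symm
    rw [hbt] at hr
    have := hmax _ (hr.cons (by rw [← hbt]; simpa using hyl) (by rw [hbb]; exact hy.symm))
    have h2 := congrArg List.length hbt
    simp only [List.length_reverse, List.length_cons] at h2 this
    omega
  set I : Finset ℕ := (Finset.range m).filter fun i => ∃ hi : i < m, G.Adj a l[i] with hI
  set J : Finset ℕ := (Finset.range m).filter fun i => ∃ hi : i < m, G.Adj b l[i] with hJ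
  have hIm : ∀ i, i ∈ I ↔ ∃ hi : i < m, G.Adj a l[i] := by
    intro i
    simp only [hI, Finset.mem_filter, Finset.mem_range, and_iff_right_iff_imp]
    exact fun ⟨h, _⟩ => h
  have hJm : ∀ i, i ∈ J ↔ ∃ hi : i < m, G.Adj b l[i] := by
    intro i
    simp only [hJ, Finset.mem_filter, Finset.mem_range, and_iff_right_iff_imp]
    exact fun ⟨h, _⟩ => h
  have hIk : k ≤ I.card := by
    refine (hk a).trans ?_
    refine (Finset.card_le_card (t := I.image fun i => l.getD i a) ?_).trans Finset.card_image_le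
    intro y hy
    rw [mem_neighborFinset] at hy
    obtain ⟨i, hi, rfl⟩ := List.getElem_of_mem (hamem y hy)
    exact Finset.mem_image.2 ⟨i, (hIm i).2 ⟨hi, hy⟩, by simp [hi]⟩
  have hJk : k ≤ J.card := by
    refine (hk b).trans ?_
    refine (Finset.card_le_card (t := J.image fun i => l.getD i a) ?_).trans Finset.card_image_le
    intro y hy
    rw [mem_neighborFinset] at hy
    obtain ⟨i, hi, rfl⟩ := List.getElem_of_mem (hbmem y hy)
    exact Finset.mem_image.2 ⟨i, (hJm i).2 ⟨hi, hy⟩, by simp [hi]⟩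
  -- Of two common neighbours of the ends, use the earlier one as neighbour of `b` and the later one
  -- as neighbour of `a`.
  have hex : ∃ g, ∃ j ∈ J, j + 1 + g ∈ I := by
    obtain ⟨x, hx, y, hy, hxy⟩ := Finset.one_lt_card.1 (hcn a b hab)
    rw [Finset.mem_inter, mem_neighborFinset, mem_neighborFinset] at hx hy
    obtain ⟨i, hi, rfl⟩ := List.getElem_of_mem (hamem x hx.1)
    obtain ⟨j, hj, rfl⟩ := List.getElem_of_mem (hamem y hy.1)
    rcases lt_trichotomy i j with hij | rfl | hij
    · refine ⟨j - i - 1, i, (hJm i).2 ⟨hi, hx.2⟩, ?_⟩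
      rw [show i + 1 + (j - i - 1) = j by omega]
      exact (hIm j).2 ⟨hj, hy.1⟩
    · exact absurd rfl hxy
    · refine ⟨i - j - 1, j, (hJm j).2 ⟨hj, hy.2⟩, ?_⟩
      rw [show j + 1 + (i - j - 1) = i by omega]
      exact (hIm i).2 ⟨hi, hx.1⟩
  -- Among the crossing pairs take one with the fewest vertices `g` between; these are the vertices
  -- that the cycle leaves out.
  obtain ⟨g, ⟨j, hj, hi⟩, hmin⟩ : ∃ g, (∃ j ∈ J, j + 1 + g ∈ I) ∧
      ∀ g', (∃ j ∈ J, j + 1 + g' ∈ I) → g ≤ g' :=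
    ⟨Nat.find hex, Nat.find_spec hex, fun g' hg' => Nat.find_min' hex hg'⟩
  obtain ⟨hjm, hbj⟩ := (hJm j).1 hj
  obtain ⟨him, hai⟩ := (hIm _).1 hi
  have hAne : l.take (j + 1) ≠ [] := by simp [hne]
  have hBne : l.drop (j + 1 + g) ≠ [] := by simpa using him
  have hsplit : l.take (j + 1) ++ ((l.drop (j + 1)).take g ++ l.drop (j + 1 + g)) = l := by
    rw [← List.drop_drop (i := g) (j := j + 1), List.take_append_drop, List.take_append_drop]
  have hcyc : G.IsCycleList (l.take (j + 1) ++ (l.drop (j + 1 + g)).reverse) := by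
    refine IsPathList.crossing (M := (l.drop (j + 1)).take g) (by rwa [hsplit]) hAne hBne ?_ ?_
    · rw [List.getLast_take, List.getLast_drop]
      simpa [List.getElem?_eq_getElem hjm] using hbj.symm
    · rw [List.head_take, List.head_drop]
      exact hai
  have hclen : (l.take (j + 1) ++ (l.drop (j + 1 + g)).reverse).length + g = m := by
    simp only [List.length_append, List.length_take, List.length_reverse, List.length_drop]
    omega
  refine ⟨_, hcyc, by simp [hne], ?_⟩
  rcases Nat.eq_zero_or_pos g with rfl | hg
  · right; omega
  left
  have hJb : m - 1 ∉ J := by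
    intro hmem
    obtain ⟨_, hh⟩ := (hJm _).1 hmem
    rw [hbm] at hh
    exact G.irrefl hh
  have hIa : 0 ∉ I := by
    intro hmem
    obtain ⟨_, hh⟩ := (hIm _).1 hmem
    rw [ha0] at hh
    exact G.irrefl hh
  -- For `g > 0`, minimality makes `J + 1`, `I` and the gap positions `j + 2, …, j + g` disjoint
  -- subsets of `[1, m - 1]`. Hence `2k + (g - 1) ≤ m - 1`, and the cycle has `m - g ≥ 2k` vertices.
  have hd1 : Disjoint (J.image (· + 1)) I := by
    rw [Finset.disjoint_left]
    intro t ht htI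
    obtain ⟨t', ht', rfl⟩ := Finset.mem_image.1 ht
    have := hmin 0 ⟨t', ht', htI⟩
    omega
  have hd2 : Disjoint (J.image (· + 1) ∪ I) (Finset.Icc (j + 2) (j + g)) := by
    rw [Finset.disjoint_left]
    intro t ht htM
    rw [Finset.mem_Icc] at htM
    rcases Finset.mem_union.1 ht with ht | ht
    · obtain ⟨t', ht', rfl⟩ := Finset.mem_image.1 ht
      have := hmin (j + g - t') ⟨t', ht', by
        rwa [show t' + 1 + (j + g - t') = j + 1 + g by omega]⟩
      omega
    · have := hmin (t - j - 1) ⟨j, hj, by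
        rwa [show j + 1 + (t - j - 1) = t by omega]⟩
      omega
  have hsub : J.image (· + 1) ∪ I ∪ Finset.Icc (j + 2) (j + g) ⊆ Finset.Icc 1 (m - 1) := by
    intro t ht
    rw [Finset.mem_Icc]
    rcases Finset.mem_union.1 ht with ht | ht
    · rcases Finset.mem_union.1 ht with ht | ht
      · obtain ⟨t', ht', rfl⟩ := Finset.mem_image.1 ht
        obtain ⟨h1, _⟩ := (hJm t').1 ht'
        have : t' ≠ m - 1 := by rintro rfl; exact hJb ht'
        omega
      · obtain ⟨h1, _⟩ := (hIm t).1 ht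
        have : t ≠ 0 := by rintro rfl; exact hIa ht
        omega
    · rw [Finset.mem_Icc] at ht
      omega
  have hc := Finset.card_le_card hsub
  rw [Finset.card_union_of_disjoint hd2, Finset.card_union_of_disjoint hd1,
    Finset.card_image_of_injective _ (add_left_injective 1), Nat.card_Icc, Nat.card_Icc] at hc
  omega

/-- A graph of order `n` is hamiltonian if its degrees are at least `k`, any two vertices have at
least two common neighbours, and independent sets have at most `3 * k + 1 - n` vertices. -/
theorem isHamiltonian_of_card_neighborFinset [Fintype V] [DecidableEq V] [DecidableRel G.Adj]
    {k : ℕ} (hk : ∀ v, k ≤ (G.neighborFinset v).card)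
    (hcn : ∀ x y, x ≠ y → 2 ≤ (G.neighborFinset x ∩ G.neighborFinset y).card)
    (hind : ∀ s : Finset V, (∀ a ∈ s, ∀ b ∈ s, ¬ G.Adj a b) →
      s.card + Fintype.card V ≤ 3 * k + 1)
    (h3 : 3 ≤ Fintype.card V) : G.IsHamiltonian := by
  obtain ⟨p, hp, hpmax⟩ := exists_maximal_length (p := G.IsPathList) (fun _ h => h.1)
    (l₀ := []) ⟨List.nodup_nil, by simp⟩
  have hp2 : 2 ≤ p.length := by
    obtain ⟨x, y, hxy⟩ := Fintype.one_lt_card_iff.1 (show 1 < Fintype.card V by omega)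
    obtain ⟨z, hz⟩ := Finset.card_pos.1 (show 0 < _ from lt_of_lt_of_le two_pos (hcn x y hxy))
    rw [Finset.mem_inter, mem_neighborFinset] at hz
    exact hpmax [x, z] ⟨by simpa using hz.1.ne, by simpa using hz.1⟩
  obtain ⟨c₀, hc₀, hc₀ne, hc₀len⟩ := hp.exists_isCycleList hk hcn hpmax hp2
  obtain ⟨c, hc, hcmax⟩ := exists_maximal_length (p := G.IsCycleList) (fun _ h => h.1) hc₀
  have hall : ∀ x, x ∈ c := by
    rcases hc₀len with h | h
    · exact hc.mem_of_maximal hk hind hcmax (h.trans (hcmax _ hc₀))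
    -- The cycle is now at least as long as a longest path. A vertex off it is linked to it through
    -- a common neighbour with a vertex on it, so some vertex off the cycle is adjacent to it, and
    -- this gives a longer path.
    · by_contra! hx
      obtain ⟨x, hx⟩ := hx
      have hlen : p.length ≤ c.length := h ▸ hcmax _ hc₀
      have hcne : c ≠ [] := by rintro rfl; rw [List.length_nil] at hlen; omega
      obtain ⟨v, hv⟩ := List.exists_mem_of_ne_nil c hcne
      have hxv : x ≠ v := by rintro rfl; exact hx hv
      obtain ⟨w, hw⟩ := Finset.card_pos.1 (show 0 < _ from lt_of_lt_of_le two_pos (hcn x v hxv))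
      rw [Finset.mem_inter, mem_neighborFinset, mem_neighborFinset] at hw
      obtain ⟨l', hl', hl'len⟩ : ∃ l', G.IsPathList l' ∧ l'.length = c.length + 1 := by
        by_cases hwc : w ∈ c
        · exact hc.exists_isPathList hx hwc hw.1
        · exact hc.exists_isPathList hwc hv hw.2.symm
      have := hpmax l' hl'
      omega
  have hcard : c.length = Fintype.card V := by
    rw [← List.toFinset_card_of_nodup hc.1, ← Finset.card_univ]
    congr 1
    ext x
    simp [hall x]
  exact isHamiltonian_of_isCycleList hc (by omega) hcard

end SimpleGraph

/-! ### Character sums of quadratic forms over `GF(2)`. -/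

/-- The nontrivial additive character of the field with two elements. -/
def binaryChar (a : ZMod 2) : ℤ := if a = 0 then 1 else -1

theorem binaryChar_zero : binaryChar 0 = 1 := rfl

theorem binaryChar_one : binaryChar 1 = -1 := rfl

theorem binaryChar_add (a b : ZMod 2) : binaryChar (a + b) = binaryChar a * binaryChar b := by
  revert a b; decide

theorem binaryChar_eq (a : ZMod 2) : binaryChar a = 1 ∨ binaryChar a = -1 := by
  revert a; decide

/-- The Fourier expansion of an indicator function, which turns the counts below into character
sums. -/
theorem two_mul_ite_eq (a b : ZMod 2) :
    2 * (if a = b then 1 else 0 : ℤ) = 1 + binaryChar b * binaryChar a := by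
  revert a b; decide

namespace QuadraticMap

variable {V : Type*} [AddCommGroup V] [Module (ZMod 2) V] (Q : QuadraticForm (ZMod 2) V)

theorem map_add_eq (x y : V) : Q (x + y) = Q x + Q y + polar Q x y := by
  rw [polar]; ring

theorem polar_self_eq_zero (x : V) : polar Q x x = 0 := by
  rw [polar_self, two_nsmul, ZModModule.add_self]

section Counting

variable [Fintype V]

section

variable {Q}

/-- Translation by a vector `w` with `B(a, w) = 1` changes the sign of every term. -/
theorem sum_binaryChar_polar (hQ : ∀ a ≠ 0, ∃ v, polar Q a v = 1) {a : V} (ha : a ≠ 0) :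
    ∑ v, binaryChar (polar Q a v) = 0 := by
  obtain ⟨w, hw⟩ := hQ a ha
  have h : ∑ v, binaryChar (polar Q a v) = ∑ v, binaryChar (polar Q a (v + w)) :=
    (Equiv.sum_comp (Equiv.addRight w) fun v => binaryChar (polar Q a v)).symm
  simp only [polar_add_right, hw, binaryChar_add, binaryChar_one, mul_neg, mul_one,
    Finset.sum_neg_distrib] at h
  omega

/-- Completing the square: `Q v + B(a, v) = Q (v + a) + Q a` in characteristic two, so a translation
absorbs the linear twist. -/
theorem sum_binaryChar_mul_polar (a : V) :
    ∑ v, binaryChar (Q v) * binaryChar (polar Q a v) =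
      binaryChar (Q a) * ∑ v, binaryChar (Q v) := by
  have h : ∑ v, binaryChar (Q v) = ∑ v, binaryChar (Q (v + a)) :=
    (Equiv.sum_comp (Equiv.addRight a) fun v => binaryChar (Q v)).symm
  rw [h, Finset.mul_sum]
  refine Finset.sum_congr rfl fun v _ => ?_
  rw [map_add_eq, binaryChar_add, binaryChar_add, polar_comm Q v a]
  rcases binaryChar_eq (Q a) with h | h <;> rw [h] <;> ring

theorem two_mul_card_filter (q : ZMod 2) :
    2 * ((Finset.univ.filter fun v => Q v = q).card : ℤ) =
      Fintype.card V + binaryChar q * ∑ v, binaryChar (Q v) := by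
  rw [Finset.card_filter]
  push_cast
  rw [Finset.mul_sum, Finset.mul_sum]
  simp only [two_mul_ite_eq, Finset.sum_add_distrib, Finset.sum_const, Finset.card_univ]
  simp

/-- Expand the product of the indicators: nontrivial linear characters sum to zero, and each twisted
sum is a sign times the Gauss sum. With two linear conditions the same works if `a`, `b` and `a + b`
are nonzero. -/
theorem four_mul_card_filter (hQ : ∀ a ≠ 0, ∃ v, polar Q a v = 1) {a : V} (ha : a ≠ 0)
    (q α : ZMod 2) :
    4 * ((Finset.univ.filter fun v => Q v = q ∧ polar Q a v = α).card : ℤ) =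
      Fintype.card V + binaryChar q * (∑ v, binaryChar (Q v)) *
        (1 + binaryChar α * binaryChar (Q a)) := by
  have h : ∀ v, 4 * (if Q v = q ∧ polar Q a v = α then 1 else 0 : ℤ) =
      1 + binaryChar q * binaryChar (Q v) + binaryChar α * binaryChar (polar Q a v) +
        binaryChar q * binaryChar α * (binaryChar (Q v) * binaryChar (polar Q a v)) := by
    intro v
    have h1 := two_mul_ite_eq (Q v) q
    have h2 := two_mul_ite_eq (polar Q a v) α
    rw [ite_and, show ∀ c : Prop, [Decidable c] → ∀ z : ℤ, (if c then z else 0) =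
      (if c then 1 else 0) * z from fun c _ z => by split_ifs <;> simp]
    linear_combination (2 * (if polar Q a v = α then 1 else 0 : ℤ)) * h1 +
      (1 + binaryChar q * binaryChar (Q v)) * h2
  rw [Finset.card_filter]
  push_cast
  rw [Finset.mul_sum]
  simp only [h, Finset.sum_add_distrib, ← Finset.mul_sum, sum_binaryChar_polar hQ ha,
    sum_binaryChar_mul_polar, Finset.sum_const, Finset.card_univ]
  simp only [nsmul_eq_mul, mul_one, mul_zero]
  ring

theorem eight_mul_card_filter (hQ : ∀ a ≠ 0, ∃ v, polar Q a v = 1) {a b : V} (ha : a ≠ 0)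
    (hb : b ≠ 0) (hab : a + b ≠ 0) (q α β : ZMod 2) :
    8 * ((Finset.univ.filter fun v => Q v = q ∧ polar Q a v = α ∧ polar Q b v = β).card : ℤ) =
      Fintype.card V + binaryChar q * (∑ v, binaryChar (Q v)) *
        (1 + binaryChar α * binaryChar (Q a) + binaryChar β * binaryChar (Q b) +
          binaryChar α * binaryChar β * binaryChar (Q (a + b))) := by
  have h : ∀ v, 8 * (if Q v = q ∧ polar Q a v = α ∧ polar Q b v = β then 1 else 0 : ℤ) =
      1 + binaryChar q * binaryChar (Q v) + binaryChar α * binaryChar (polar Q a v) +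
        binaryChar β * binaryChar (polar Q b v) +
        binaryChar α * binaryChar β * binaryChar (polar Q (a + b) v) +
        binaryChar q * binaryChar α * (binaryChar (Q v) * binaryChar (polar Q a v)) +
        binaryChar q * binaryChar β * (binaryChar (Q v) * binaryChar (polar Q b v)) +
        binaryChar q * binaryChar α * binaryChar β *
          (binaryChar (Q v) * binaryChar (polar Q (a + b) v)) := by
    intro v
    have h1 := two_mul_ite_eq (Q v) q
    have h2 := two_mul_ite_eq (polar Q a v) α
    have h3 := two_mul_ite_eq (polar Q b v) β
    rw [polar_add_left, binaryChar_add]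
    have e : (if Q v = q ∧ polar Q a v = α ∧ polar Q b v = β then 1 else 0 : ℤ) =
        (if Q v = q then 1 else 0) * (if polar Q a v = α then 1 else 0) *
          (if polar Q b v = β then 1 else 0) := by
      simp only [ite_and, mul_ite, mul_one, mul_zero]
      split_ifs <;> rfl
    rw [e]
    linear_combination (4 * (if polar Q a v = α then 1 else 0 : ℤ) *
        (if polar Q b v = β then 1 else 0 : ℤ)) * h1 +
      (2 * (1 + binaryChar q * binaryChar (Q v)) * (if polar Q b v = β then 1 else 0 : ℤ)) * h2 +
      (1 + binaryChar q * binaryChar (Q v)) *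
        (1 + binaryChar α * binaryChar (polar Q a v)) * h3
  rw [Finset.card_filter]
  push_cast
  rw [Finset.mul_sum]
  simp only [h, Finset.sum_add_distrib, ← Finset.mul_sum, sum_binaryChar_polar hQ ha,
    sum_binaryChar_polar hQ hb, sum_binaryChar_polar hQ hab,
    sum_binaryChar_mul_polar, Finset.sum_const, Finset.card_univ]
  simp only [nsmul_eq_mul, mul_one, mul_zero]
  ring

/-- Sixteen times the number of solutions is `|V| + T S`, where `S` is the Gauss sum and `T` is one
plus seven signs, one for each nonzero combination of the independent vectors `a`, `b`, `c`. The
bounds on `S` make this positive. -/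
theorem exists_eq_zero_of_three_polar_eq (hQ : ∀ a ≠ 0, ∃ v, polar Q a v = 1) {a b c : V}
    (ha : a ≠ 0) (hb : b ≠ 0) (hc : c ≠ 0) (hab : a + b ≠ 0) (hac : a + c ≠ 0) (hbc : b + c ≠ 0)
    (habc : a + b + c ≠ 0) (α β γ : ZMod 2)
    (hS : 6 * ∑ v, binaryChar (Q v) < Fintype.card V)
    (hS' : -8 * ∑ v, binaryChar (Q v) < Fintype.card V) :
    ∃ v, Q v = 0 ∧ polar Q a v = α ∧ polar Q b v = β ∧ polar Q c v = γ := by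
  by_contra! hne
  set A := binaryChar α with hA
  set B := binaryChar β with hB
  set C := binaryChar γ with hC
  have h0 : ∀ v, (1 + binaryChar (Q v)) * (1 + A * binaryChar (polar Q a v)) *
      (1 + B * binaryChar (polar Q b v)) * (1 + C * binaryChar (polar Q c v)) = 0 := by
    intro v
    have h1 := two_mul_ite_eq (Q v) 0
    rw [binaryChar_zero, one_mul] at h1
    rw [← h1, ← two_mul_ite_eq (polar Q a v) α, ← two_mul_ite_eq (polar Q b v) β,
      ← two_mul_ite_eq (polar Q c v) γ]
    have := hne v
    clear h1
    split_ifs <;> simp_all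
  have h : ∀ v, (1 + binaryChar (Q v)) * (1 + A * binaryChar (polar Q a v)) *
      (1 + B * binaryChar (polar Q b v)) * (1 + C * binaryChar (polar Q c v)) =
      1 + A * binaryChar (polar Q a v) + B * binaryChar (polar Q b v) +
      C * binaryChar (polar Q c v) + A * B * binaryChar (polar Q (a + b) v) +
      A * C * binaryChar (polar Q (a + c) v) + B * C * binaryChar (polar Q (b + c) v) +
      A * B * C * binaryChar (polar Q (a + b + c) v) +
      binaryChar (Q v) + A * (binaryChar (Q v) * binaryChar (polar Q a v)) +
      B * (binaryChar (Q v) * binaryChar (polar Q b v)) +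
      C * (binaryChar (Q v) * binaryChar (polar Q c v)) +
      A * B * (binaryChar (Q v) * binaryChar (polar Q (a + b) v)) +
      A * C * (binaryChar (Q v) * binaryChar (polar Q (a + c) v)) +
      B * C * (binaryChar (Q v) * binaryChar (polar Q (b + c) v)) +
      A * B * C * (binaryChar (Q v) * binaryChar (polar Q (a + b + c) v)) := by
    intro v
    simp only [polar_add_left, binaryChar_add]
    ring
  have hsum := Finset.sum_congr (rfl : (Finset.univ : Finset V) = _) fun v _ => (h v).symm.trans (h0 v)
  simp only [Finset.sum_add_distrib, ← Finset.mul_sum, sum_binaryChar_polar hQ ha,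
    sum_binaryChar_polar hQ hb, sum_binaryChar_polar hQ hc, sum_binaryChar_polar hQ hab,
    sum_binaryChar_polar hQ hac, sum_binaryChar_polar hQ hbc, sum_binaryChar_polar hQ habc,
    sum_binaryChar_mul_polar, Finset.sum_const, Finset.card_univ, nsmul_eq_mul, mul_one, mul_zero,
    add_zero] at hsum
  have hpm : ∀ x y : ℤ, (x = 1 ∨ x = -1) → (y = 1 ∨ y = -1) → (x * y = 1 ∨ x * y = -1) := by
    rintro x y (rfl | rfl) (rfl | rfl) <;> simp
  have hA' := binaryChar_eq α
  have hB' := binaryChar_eq β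
  have hC' := binaryChar_eq γ
  have t1 := hpm _ _ hA' (binaryChar_eq (Q a))
  have t2 := hpm _ _ hB' (binaryChar_eq (Q b))
  have t3 := hpm _ _ hC' (binaryChar_eq (Q c))
  have t4 := hpm _ _ (hpm _ _ hA' hB') (binaryChar_eq (Q (a + b)))
  have t5 := hpm _ _ (hpm _ _ hA' hC') (binaryChar_eq (Q (a + c)))
  have t6 := hpm _ _ (hpm _ _ hB' hC') (binaryChar_eq (Q (b + c)))
  have t7 := hpm _ _ (hpm _ _ (hpm _ _ hA' hB') hC') (binaryChar_eq (Q (a + b + c)))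
  simp only [← hA, ← hB, ← hC] at t1 t2 t3 t4 t5 t6 t7
  simp only [← mul_assoc] at hsum
  generalize A * binaryChar (Q a) = T1 at *
  generalize B * binaryChar (Q b) = T2 at *
  generalize C * binaryChar (Q c) = T3 at *
  generalize A * B * binaryChar (Q (a + b)) = T4 at *
  generalize A * C * binaryChar (Q (a + c)) = T5 at *
  generalize B * C * binaryChar (Q (b + c)) = T6 at *
  generalize A * B * C * binaryChar (Q (a + b + c)) = T7 at *
  generalize ∑ v, binaryChar (Q v) = S at *
  -- The extreme values `-6` and `8` of `T` are the source of the constants in `hS` and `hS'`.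
  have hT1 : -6 ≤ 1 + T1 + T2 + T3 + T4 + T5 + T6 + T7 := by omega
  have hT2 : 1 + T1 + T2 + T3 + T4 + T5 + T6 + T7 ≤ 8 := by omega
  have hs : (Fintype.card V : ℤ) + (1 + T1 + T2 + T3 + T4 + T5 + T6 + T7) * S = 0 := by
    linear_combination hsum
  rcases le_total 0 S with h | h
  · nlinarith
  · nlinarith

/-- The square of a character sum over a set of vectors, summed over the whole space. -/
theorem sum_sq_sum_binaryChar [DecidableEq V] (hQ : ∀ a ≠ 0, ∃ v, polar Q a v = 1)
    (s : Finset V) :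
    ∑ v, (∑ x ∈ s, binaryChar (polar Q x v)) ^ 2 = Fintype.card V * s.card := by
  have h : ∀ v, (∑ x ∈ s, binaryChar (polar Q x v)) ^ 2 =
      ∑ x ∈ s, ∑ y ∈ s, binaryChar (polar Q (x + y) v) := by
    intro v
    rw [pow_two, Finset.sum_mul_sum]
    simp only [polar_add_left, binaryChar_add]
  simp only [h]
  rw [Finset.sum_comm]
  have h2 : ∀ x ∈ s, ∑ v, ∑ y ∈ s, binaryChar (polar Q (x + y) v) = Fintype.card V := by
    intro x hx
    -- Only the diagonal term `y = x` survives, since otherwise `x + y ≠ 0`.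
    rw [Finset.sum_comm, Finset.sum_eq_single x]
    · simp [ZModModule.add_self, polar_zero_left, binaryChar_zero]
    · intro y _ hyx
      apply sum_binaryChar_polar hQ
      intro h0
      exact hyx (by rw [← sub_eq_zero, ← h0, ZModModule.sub_eq_add, add_comm])
    · exact fun h => absurd hx h
  rw [Finset.sum_congr rfl h2, Finset.sum_const, nsmul_eq_mul, mul_comm]

/-- A set of vectors whose character sums are at least `m` in absolute value at its own members
satisfies `m ^ 2 ≤ card V`. -/
theorem sq_le_card [DecidableEq V] (hQ : ∀ a ≠ 0, ∃ v, polar Q a v = 1) {s : Finset V}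
    (hs : s.Nonempty) {m : ℤ} (hm : ∀ v ∈ s, m ^ 2 = (∑ x ∈ s, binaryChar (polar Q x v)) ^ 2) :
    m ^ 2 ≤ Fintype.card V := by
  -- In the Parseval identity keep only the terms with `v ∈ s`.
  have h1 : (s.card : ℤ) * m ^ 2 ≤ Fintype.card V * s.card := by
    rw [← sum_sq_sum_binaryChar hQ, ← nsmul_eq_mul, ← Finset.sum_const, Finset.sum_congr rfl hm]
    exact Finset.sum_le_sum_of_subset_of_nonneg (Finset.subset_univ s) fun _ _ _ => sq_nonneg _
  have h2 : (0 : ℤ) < s.card := by exact_mod_cast hs.card_pos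
  nlinarith

/-- Pairwise orthogonal vectors. -/
theorem card_sq_le_of_polar_eq_zero [DecidableEq V] (hQ : ∀ a ≠ 0, ∃ v, polar Q a v = 1)
    {s : Finset V} (hs : s.Nonempty) (h0 : ∀ x ∈ s, ∀ y ∈ s, polar Q x y = 0) :
    (s.card : ℤ) ^ 2 ≤ Fintype.card V := by
  refine sq_le_card hQ hs fun v hv => ?_
  rw [Finset.sum_congr rfl fun x hx => by rw [h0 x hx v hv, binaryChar_zero]]
  simp

/-- Pairwise non-orthogonal vectors. -/
theorem card_sub_two_sq_le_of_polar_eq_one [DecidableEq V]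
    (hQ : ∀ a ≠ 0, ∃ v, polar Q a v = 1) {s : Finset V} (hs : s.Nonempty)
    (h1 : ∀ x ∈ s, ∀ y ∈ s, x ≠ y → polar Q x y = 1) :
    ((s.card : ℤ) - 2) ^ 2 ≤ Fintype.card V := by
  refine sq_le_card hQ hs fun v hv => ?_
  -- At `v ∈ s` the diagonal term is `1` and the others are `-1`, so the sum is `2 - s.card`.
  rw [← Finset.sum_erase_add _ _ hv, Finset.sum_congr rfl fun x hx => by
    rw [h1 x (Finset.mem_of_mem_erase hx) v hv (Finset.ne_of_mem_erase hx), binaryChar_one]]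
  rw [polar_self_eq_zero, binaryChar_zero, Finset.sum_const, Finset.card_erase_of_mem hv,
    nsmul_eq_mul, Nat.cast_sub hs.card_pos]
  push_cast
  ring

end

end Counting

end QuadraticMap

/-! ### Orthogonal transvections and the transitivity of `PΩ`. -/

section Orthogonal

open QuadraticMap

variable {V : Type*} [AddCommGroup V] [Module (ZMod 2) V] (Q : QuadraticForm (ZMod 2) V)

/-- The orthogonal transvection `v ↦ v + B(u, v) u` along a nonsingular vector `u`. -/
def orthogonalTransvection (u : V) (hu : Q u = 1) : isometryGroup Q :=
  ⟨LinearEquiv.ofInvolutive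
    (LinearMap.id + ((polarBilin Q u).smulRight u))
    (fun v => by
      simp only [LinearMap.add_apply, LinearMap.id_apply, LinearMap.smulRight_apply,
        polarBilin_apply_apply, polar_add_right, polar_smul_right, polar_self_eq_zero, smul_zero,
        add_zero]
      rw [add_assoc, ZModModule.add_self, add_zero]),
  fun v => by
    change Q (v + polar Q u v • u) = Q v
    rw [map_add_eq, QuadraticMap.map_smul, polar_smul_right, polar_comm Q v u, hu]
    generalize polar Q u v = c
    generalize Q v = e
    revert c e
    decide⟩

variable {Q}

theorem orthogonalTransvection_apply (u : V) (hu : Q u = 1) (v : V) :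
    (orthogonalTransvection Q u hu).1 v = v + polar Q u v • u := rfl

theorem polar_isometry (g : isometryGroup Q) (v w : V) :
    polar Q (g.1 v) (g.1 w) = polar Q v w := by
  rw [polar, polar, ← map_add, g.2, g.2, g.2]

theorem conj_orthogonalTransvection (g : isometryGroup Q) (u : V) (hu : Q u = 1) :
    g * orthogonalTransvection Q u hu * g⁻¹ =
      orthogonalTransvection Q (g.1 u) ((g.2 u).trans hu) := by
  rw [mul_inv_eq_iff_eq_mul]
  apply Subtype.ext
  apply LinearEquiv.ext
  intro v
  change g.1 ((orthogonalTransvection Q u hu).1 v) =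
    (orthogonalTransvection Q (g.1 u) ((g.2 u).trans hu)).1 (g.1 v)
  rw [orthogonalTransvection_apply, orthogonalTransvection_apply, polar_isometry, map_add,
    _root_.map_smul]

theorem orthogonalTransvection_mul_self (u : V) (hu : Q u = 1) :
    orthogonalTransvection Q u hu * orthogonalTransvection Q u hu = 1 := by
  apply Subtype.ext
  apply LinearEquiv.ext
  intro v
  change (orthogonalTransvection Q u hu).1 ((orthogonalTransvection Q u hu).1 v) = v
  rw [orthogonalTransvection_apply, orthogonalTransvection_apply, polar_add_right,
    polar_smul_right, polar_self_eq_zero, smul_zero, add_zero, add_assoc, ZModModule.add_self,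
    add_zero]

/-- The transvection along `a + b` maps `a` to `b`, if `Q a = Q b` and `B(a, b) = 1`. -/
theorem orthogonalTransvection_add_apply {a b : V} (hu : Q (a + b) = 1) (hab : polar Q a b = 1) :
    (orthogonalTransvection Q (a + b) hu).1 a = b := by
  rw [orthogonalTransvection_apply, polar_add_left, polar_self_eq_zero, polar_comm Q b a, hab,
    zero_add, one_smul, ← add_assoc, ZModModule.add_self, zero_add]

theorem orthogonalTransvection_apply_of_polar_eq_zero {u v : V} (hu : Q u = 1)
    (h : polar Q u v = 0) : (orthogonalTransvection Q u hu).1 v = v := by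
  rw [orthogonalTransvection_apply, h, zero_smul, add_zero]

/-- The vector `u + v` is nonsingular and its transvection carries `u` to `v`, so the two
transvections are conjugate. -/
theorem abelianization_of_eq_of_polar_eq_one {u v : V} (hu : Q u = 1) (hv : Q v = 1)
    (huv : polar Q u v = 1) :
    Abelianization.of (orthogonalTransvection Q u hu) =
      Abelianization.of (orthogonalTransvection Q v hv) := by
  have h : Q (u + v) = 1 := by rw [map_add_eq, hu, hv, huv]; decide
  have h1 := conj_orthogonalTransvection (orthogonalTransvection Q (u + v) h) u hu
  have h2 := congrArg Abelianization.of h1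
  simp only [orthogonalTransvection_add_apply h huv, map_mul, map_inv,
    mul_inv_cancel_comm] at h2
  exact h2

theorem add_ne_zero_of_ne {a b : V} (h : a ≠ b) : a + b ≠ 0 := by
  rwa [← ZModModule.sub_eq_add, sub_ne_zero]

variable (Q) in
/-- The subgroup generated by all orthogonal transvections. -/
def transvectionSubgroup : Subgroup (isometryGroup Q) :=
  Subgroup.closure {g | ∃ u, ∃ hu : Q u = 1, g = orthogonalTransvection Q u hu}

theorem exists_mem_transvectionSubgroup_swap {a b : V} (ha : Q a = 0) (hb : Q b = 0)
    (hab : polar Q a b = 1) :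
    ∃ g ∈ transvectionSubgroup Q, g.1 a = b ∧ ∀ x, polar Q a x = polar Q b x → g.1 x = x := by
  have hu : Q (a + b) = 1 := by rw [map_add_eq, ha, hb, hab]; decide
  refine ⟨orthogonalTransvection Q (a + b) hu, Subgroup.subset_closure ⟨_, hu, rfl⟩,
    orthogonalTransvection_add_apply hu hab, fun x hx => ?_⟩
  apply orthogonalTransvection_apply_of_polar_eq_zero
  rw [polar_add_left, hx, ZModModule.add_self]

theorem ZMod.eq_zero_or_eq_one (a : ZMod 2) : a = 0 ∨ a = 1 := by
  revert a; decide

variable [Fintype V]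

variable (Q) in
/-- The properties of the form that are used for counting: it is nondegenerate, and its Gauss sum
is small. -/
structure GaussSumSmall : Prop where
  nondegenerate : ∀ a ≠ 0, ∃ v, polar Q a v = 1
  upper : 6 * ∑ v, binaryChar (Q v) < Fintype.card V
  lower : -8 * ∑ v, binaryChar (Q v) < Fintype.card V

/-- The count is `(|V| ± T S) / 8` with `T` between `-2` and `4`, and the bounds on `S` give `4|S| <
|V|`. Over `GF(2)` distinct nonzero vectors are independent. -/
theorem GaussSumSmall.exists_of_two (hQ : GaussSumSmall Q) {a b : V} (ha : a ≠ 0)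
    (hb : b ≠ 0) (hab : a ≠ b) (q α β : ZMod 2) :
    ∃ v, Q v = q ∧ polar Q a v = α ∧ polar Q b v = β := by
  have h := eight_mul_card_filter hQ.nondegenerate ha hb (add_ne_zero_of_ne hab) q α β
  have hu := hQ.upper
  have hl := hQ.lower
  have hpm : ∀ x y : ℤ, (x = 1 ∨ x = -1) → (y = 1 ∨ y = -1) → (x * y = 1 ∨ x * y = -1) := by
    rintro x y (rfl | rfl) (rfl | rfl) <;> simp
  have t0 := binaryChar_eq q
  have t1 := hpm _ _ (binaryChar_eq α) (binaryChar_eq (Q a))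
  have t2 := hpm _ _ (binaryChar_eq β) (binaryChar_eq (Q b))
  have t3 := hpm _ _ (hpm _ _ (binaryChar_eq α) (binaryChar_eq β)) (binaryChar_eq (Q (a + b)))
  generalize binaryChar α * binaryChar (Q a) = T1 at *
  generalize binaryChar β * binaryChar (Q b) = T2 at *
  generalize binaryChar α * binaryChar β * binaryChar (Q (a + b)) = T3 at *
  generalize ∑ v, binaryChar (Q v) = S at *
  have hpos : 0 < (Finset.univ.filter fun v =>
      Q v = q ∧ polar Q a v = α ∧ polar Q b v = β).card := by
    have : (0 : ℤ) < 8 * ((Finset.univ.filter fun v =>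
      Q v = q ∧ polar Q a v = α ∧ polar Q b v = β).card : ℤ) := by
      rw [h]
      rcases t0 with t0 | t0 <;> rcases t1 with t1 | t1 <;> rcases t2 with t2 | t2 <;>
        rcases t3 with t3 | t3 <;> rw [t0, t1, t2, t3] <;> omega
    omega
  obtain ⟨v, hv⟩ := Finset.card_pos.1 hpos
  exact ⟨v, (Finset.mem_filter.1 hv).2⟩

/-- Some nonsingular `w` is non-orthogonal to both `u` and `v` and links their transvections. -/
theorem GaussSumSmall.abelianization_of_eq (hQ : GaussSumSmall Q) {u v : V} (hu : Q u = 1)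
    (hv : Q v = 1) :
    Abelianization.of (orthogonalTransvection Q u hu) =
      Abelianization.of (orthogonalTransvection Q v hv) := by
  have hne : ∀ x : V, Q x = 1 → x ≠ 0 := by
    rintro x hx rfl
    rw [QuadraticMap.map_zero] at hx
    exact absurd hx (by decide)
  rcases eq_or_ne u v with rfl | huv
  · rfl
  obtain ⟨w, hw, huw, hvw⟩ := hQ.exists_of_two (hne u hu) (hne v hv) huv 1 1 1
  exact (abelianization_of_eq_of_polar_eq_one hu hw huw).trans
    (abelianization_of_eq_of_polar_eq_one hv hw hvw).symm

/-- All transvections have the same image, an element of order at most two. -/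
theorem GaussSumSmall.abelianization_of_mem (hQ : GaussSumSmall Q) {g : isometryGroup Q}
    (hg : g ∈ transvectionSubgroup Q) {u : V} (hu : Q u = 1) :
    Abelianization.of g = 1 ∨
      Abelianization.of g = Abelianization.of (orthogonalTransvection Q u hu) := by
  set τ := Abelianization.of (orthogonalTransvection Q u hu) with hτ
  have hττ : τ * τ = 1 := by
    rw [hτ, ← map_mul, orthogonalTransvection_mul_self, map_one]
  have hle : transvectionSubgroup Q ≤ (Subgroup.zpowers τ).comap Abelianization.of := by
    rw [transvectionSubgroup, Subgroup.closure_le]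
    rintro _ ⟨v, hv, rfl⟩
    rw [SetLike.mem_coe, Subgroup.mem_comap, hQ.abelianization_of_eq hv hu]
    exact Subgroup.mem_zpowers τ
  obtain ⟨k, hk⟩ := Subgroup.mem_zpowers_iff.1 (Subgroup.mem_comap.1 (hle hg))
  rw [← hk]
  rcases Int.even_or_odd' k with ⟨m, rfl | rfl⟩
  · left
    rw [zpow_mul, zpow_two, hττ, one_zpow]
  · right
    rw [zpow_add, zpow_mul, zpow_two, hττ, one_zpow, one_mul, zpow_one]

theorem GaussSumSmall.exists_map_eq (hQ : GaussSumSmall Q) {a c : V} (ha : a ≠ 0) (hc : c ≠ 0)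
    (hQa : Q a = 0) (hQc : Q c = 0) : ∃ g ∈ transvectionSubgroup Q, g.1 a = c := by
  rcases eq_or_ne a c with rfl | hac
  · exact ⟨1, one_mem _, rfl⟩
  obtain ⟨e, hQe, hae, hce⟩ := hQ.exists_of_two ha hc hac 0 1 1
  obtain ⟨g, hg, hgae, -⟩ := exists_mem_transvectionSubgroup_swap hQa hQe hae
  obtain ⟨k, hk, hkec, -⟩ := exists_mem_transvectionSubgroup_swap hQe hQc
    ((polar_comm Q e c).trans hce)
  refine ⟨k * g, mul_mem hk hg, ?_⟩
  change k.1 (g.1 a) = c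
  rw [hgae, hkec]

/-- If `B(b, d) = 1`, the transvection along `b + d` works, since `b + d` is orthogonal to `a`.
Otherwise go from `b` to `d` through a singular `e` non-orthogonal to both, with `B(a, e) = B(a, b)`
so that both steps fix `a`. -/
theorem GaussSumSmall.exists_map_eq_of_fixed (hQ : GaussSumSmall Q) {a b d : V} (ha : a ≠ 0)
    (hb : b ≠ 0) (hd : d ≠ 0) (hab : a ≠ b) (had : a ≠ d) (hQb : Q b = 0)
    (hQd : Q d = 0) (hp : polar Q a b = polar Q a d) :
    ∃ g ∈ transvectionSubgroup Q, g.1 a = a ∧ g.1 b = d := by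
  rcases eq_or_ne b d with rfl | hbd
  · exact ⟨1, one_mem _, rfl, rfl⟩
  rcases ZMod.eq_zero_or_eq_one (polar Q b d) with h0 | h1
  · obtain ⟨e, hQe, hae, hbe, hde⟩ : ∃ e, Q e = 0 ∧ polar Q a e = polar Q a b ∧
        polar Q b e = 1 ∧ polar Q d e = 1 := by
      -- Here `a`, `b`, `d` are dependent. Then `B(b, d) = 0` forces `B(a, b) = 0`, and the
      -- condition at `d = a + b` follows from those at `a` and `b`.
      by_cases habd : a + b + d = 0
      · have hd' : d = a + b := by
          rw [← ZModModule.sub_eq_add, sub_eq_zero] at habd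
          exact habd.symm
        subst hd'
        rw [polar_add_right, polar_self_eq_zero, add_zero, polar_comm] at h0
        obtain ⟨e, hQe, hae, hbe⟩ := hQ.exists_of_two ha hb hab 0 0 1
        refine ⟨e, hQe, by rw [hae, h0], hbe, ?_⟩
        rw [polar_add_left, hae, hbe, zero_add]
      · exact exists_eq_zero_of_three_polar_eq hQ.nondegenerate ha hb hd (add_ne_zero_of_ne hab)
          (add_ne_zero_of_ne had) (add_ne_zero_of_ne hbd) habd _ _ _ hQ.upper hQ.lower
    obtain ⟨g, hg, hgbe, hgfix⟩ := exists_mem_transvectionSubgroup_swap hQb hQe hbe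
    obtain ⟨k, hk, hked, hkfix⟩ := exists_mem_transvectionSubgroup_swap hQe hQd
      ((polar_comm Q e d).trans hde)
    refine ⟨k * g, mul_mem hk hg, ?_, ?_⟩
    · change k.1 (g.1 a) = a
      rw [hgfix a (by rw [polar_comm, ← hae, polar_comm]),
        hkfix a (by rw [polar_comm, hae, hp, polar_comm])]
    · change k.1 (g.1 b) = d
      rw [hgbe, hked]
  · obtain ⟨g, hg, hgbd, hgfix⟩ := exists_mem_transvectionSubgroup_swap hQb hQd h1
    exact ⟨g, hg, hgfix a (by rw [polar_comm, hp, polar_comm]), hgbd⟩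

/-- `PΩ` is transitive on the pairs of distinct singular vectors with a given inner product. -/
theorem GaussSumSmall.exists_POmega_map_eq (hQ : GaussSumSmall Q) {a b c d : V} (ha : a ≠ 0)
    (hb : b ≠ 0) (hc : c ≠ 0) (hd : d ≠ 0) (hab : a ≠ b) (hcd : c ≠ d) (hQa : Q a = 0)
    (hQb : Q b = 0) (hQc : Q c = 0) (hQd : Q d = 0) (hp : polar Q a b = polar Q c d) :
    ∃ g ∈ POmega Q, g.1 a = c ∧ g.1 b = d := by
  obtain ⟨g₁, hg₁, hac⟩ := hQ.exists_map_eq ha hc hQa hQc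
  obtain ⟨g₂, hg₂, h2c, h2d⟩ := hQ.exists_map_eq_of_fixed (b := g₁.1 b) hc
    (by simpa using hb) hd (by rw [← hac]; simpa using hab) hcd ((g₁.2 b).trans hQb) hQd
    (by rw [← hp, ← hac, polar_isometry])
  -- The transvection along a nonsingular `u` orthogonal to `a` and `b` fixes both. Multiplying by
  -- it, if need be, makes the image in the abelianization trivial.
  obtain ⟨u, hu, hau, hbu⟩ := hQ.exists_of_two ha hb hab 1 0 0
  have hta := orthogonalTransvection_apply_of_polar_eq_zero hu ((polar_comm Q u a).trans hau)
  have htb := orthogonalTransvection_apply_of_polar_eq_zero hu ((polar_comm Q u b).trans hbu)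
  rw [POmega, ← Abelianization.ker_of]
  rcases hQ.abelianization_of_mem (mul_mem hg₂ hg₁) hu with h | h
  · refine ⟨g₂ * g₁, h, ?_, ?_⟩
    · change g₂.1 (g₁.1 a) = c
      rw [hac, h2c]
    · exact h2d
  · refine ⟨g₂ * g₁ * orthogonalTransvection Q u hu, ?_, ?_, ?_⟩
    · rw [MonoidHom.mem_ker, map_mul, h, ← map_mul, orthogonalTransvection_mul_self, map_one]
    · change g₂.1 (g₁.1 ((orthogonalTransvection Q u hu).1 a)) = c
      rw [hta, hac, h2c]
    · change g₂.1 (g₁.1 ((orthogonalTransvection Q u hu).1 b)) = d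
      rw [htb, h2d]

end Orthogonal

/-! ### Invariance of adjacency, and passage to a spanning subgraph. -/

section GeneralizedOrbital

theorem IsGeneralizedOrbitalGraph.adj_smul {G Ω : Type*} [Group G] [MulAction G Ω]
    {X : SimpleGraph Ω} (hX : IsGeneralizedOrbitalGraph G X) {x y : Ω} (h : X.Adj x y) (g : G) :
    X.Adj (g • x) (g • y) := by
  obtain ⟨𝒪, h𝒪, hadj⟩ := hX
  rw [hadj] at h ⊢
  obtain ⟨S, hS, hxy⟩ := h
  obtain ⟨z, rfl⟩ := h𝒪 S hS
  exact ⟨_, hS, MulAction.mem_orbit_of_mem_orbit g hxy⟩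

theorem SimpleGraph.IsHamiltonian.of_bijective_hom {α β : Type*} [Fintype α] [DecidableEq α]
    [Fintype β] [DecidableEq β] {G : SimpleGraph α} {H : SimpleGraph β} (hG : G.IsHamiltonian)
    (f : G →g H) (hf : Function.Bijective f) : H.IsHamiltonian := by
  intro hβ
  rw [← Fintype.card_of_bijective hf] at hβ
  obtain ⟨a, p, hp⟩ := hG hβ
  exact ⟨_, p.map f, hp.map hf⟩

end GeneralizedOrbital

/-! ### Hamilton cycles on singular vectors. -/

section Orthogonal

open QuadraticMap

variable {V : Type*} [AddCommGroup V] [Module (ZMod 2) V] (Q : QuadraticForm (ZMod 2) V)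

/-- The graph on the nonzero singular vectors in which two distinct vectors are adjacent if their
inner product is `β`. -/
def singularGraph (β : ZMod 2) : SimpleGraph {v : V // v ≠ 0 ∧ Q v = 0} where
  Adj v w := v ≠ w ∧ polar Q v.1 w.1 = β
  symm := ⟨fun _ _ h => ⟨h.1.symm, (polar_comm Q _ _).trans h.2⟩⟩
  loopless := ⟨fun _ h => h.1 rfl⟩

/-- Compares counts of vectors in `V` with counts of vertices; `E` holds the few solutions, such as
`0`, to be discarded. -/
theorem card_le_card_add_card_of_forall {α : Type*} [DecidableEq α] {p : α → Prop}
    {F : Finset {a // p a}} {T E : Finset α}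
    (h : ∀ w ∈ T, w ∉ E → ∃ hw : p w, (⟨w, hw⟩ : {a // p a}) ∈ F) :
    T.card ≤ F.card + E.card := by
  have hsub : T ⊆ F.map (Function.Embedding.subtype p) ∪ E := by
    intro w hw
    by_cases hE : w ∈ E
    · exact Finset.mem_union_right _ hE
    · obtain ⟨hp, hF⟩ := h w hw hE
      exact Finset.mem_union_left _ (Finset.mem_map.2 ⟨_, hF, rfl⟩)
  have := (Finset.card_le_card hsub).trans (Finset.card_union_le _ _)
  rwa [Finset.card_map] at this

variable {Q}

theorem GaussSumSmall.isHamiltonian_singularGraph [Fintype V]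
    [DecidableEq {v : V // v ≠ 0 ∧ Q v = 0}] [Fintype {v : V // v ≠ 0 ∧ Q v = 0}]
    (hQ : GaussSumSmall Q) {x : ℤ} (hcard : Fintype.card V = x ^ 2) (hx : 8 ≤ x)
    (hS : ∑ v, binaryChar (Q v) = x ∨ ∑ v, binaryChar (Q v) = -x ∧ 16 ≤ x) (β : ZMod 2) :
    (singularGraph Q β).IsHamiltonian := by
  classical
  set S := ∑ v, binaryChar (Q v) with hSdef
  have hn : 2 * ((Fintype.card {v : V // v ≠ 0 ∧ Q v = 0} : ℤ) + 1) = x ^ 2 + S := by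
    rw [← hcard, Fintype.card_subtype]
    have h1 := two_mul_card_filter (Q := Q) 0
    rw [binaryChar_zero, one_mul, ← hSdef] at h1
    rw [← h1]
    have h2 : (Finset.univ.filter fun v => Q v = 0) =
        insert 0 (Finset.univ.filter fun v => v ≠ 0 ∧ Q v = 0) := by
      ext v
      simp only [Finset.mem_insert, Finset.mem_filter, Finset.mem_univ, true_and]
      by_cases hv : v = 0
      · simp [hv]
      · simp [hv]
    rw [h2, Finset.card_insert_of_notMem (by simp)]
    push_cast
    rfl
  have hS' : -x ≤ S := by rcases hS with h | h <;> omega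
  have hn3 : 3 ≤ Fintype.card {v : V // v ≠ 0 ∧ Q v = 0} := by
    have : (3 : ℤ) ≤ Fintype.card {v : V // v ≠ 0 ∧ Q v = 0} := by nlinarith
    exact_mod_cast this
  have hdeg : ∀ v : {v : V // v ≠ 0 ∧ Q v = 0},
      4 * ((Finset.univ.filter fun w => Q w = 0 ∧ polar Q v.1 w = β).card : ℤ) =
        x ^ 2 + S * (1 + binaryChar β) := by
    intro v
    rw [four_mul_card_filter hQ.nondegenerate v.2.1, v.2.2, binaryChar_zero, hcard, one_mul,
      mul_one]
  -- `k + 2` is the number of singular `w` with `B(v, w) = β`, of which at most `0` and `v` are not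
  -- neighbours of `v`.
  obtain ⟨k, hk⟩ : ∃ k : ℕ, 4 * ((k : ℤ) + 2) = x ^ 2 + S * (1 + binaryChar β) := by
    obtain ⟨v⟩ : Nonempty {v : V // v ≠ 0 ∧ Q v = 0} := Fintype.card_pos_iff.1 (by omega)
    have h := hdeg v
    have h2 : 2 ≤ (Finset.univ.filter fun w => Q w = 0 ∧ polar Q v.1 w = β).card := by
      have : (8 : ℤ) ≤
          4 * ((Finset.univ.filter fun w => Q w = 0 ∧ polar Q v.1 w = β).card : ℤ) := by
        rw [h]
        rcases binaryChar_eq β with h | h <;> rw [h] <;> nlinarith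
      omega
    refine ⟨(Finset.univ.filter fun w => Q w = 0 ∧ polar Q v.1 w = β).card - 2, ?_⟩
    rw [← h]
    push_cast [h2]
    ring
  refine SimpleGraph.isHamiltonian_of_card_neighborFinset (k := k) ?_ ?_ ?_ hn3
  · intro v
    have h := card_le_card_add_card_of_forall
      (F := (singularGraph Q β).neighborFinset v)
      (T := Finset.univ.filter fun w => Q w = 0 ∧ polar Q v.1 w = β) (E := {0, v.1}) ?_
    · have h2 : ({0, v.1} : Finset V).card ≤ 2 := Finset.card_le_two
      have := hdeg v
      omega
    · intro w hw hE
      simp only [Finset.mem_filter, Finset.mem_univ, true_and] at hw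
      simp only [Finset.mem_insert, Finset.mem_singleton, not_or] at hE
      refine ⟨⟨hE.1, hw.1⟩, ?_⟩
      rw [SimpleGraph.mem_neighborFinset]
      exact ⟨fun h => hE.2 (congrArg Subtype.val h).symm, hw.2⟩
  · intro v w hvw
    have hvw' : v.1 ≠ w.1 := fun h => hvw (Subtype.ext h)
    have h := card_le_card_add_card_of_forall
      (F := (singularGraph Q β).neighborFinset v ∩ (singularGraph Q β).neighborFinset w)
      (T := Finset.univ.filter fun u => Q u = 0 ∧ polar Q v.1 u = β ∧ polar Q w.1 u = β)
      (E := {0, v.1, w.1}) ?_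
    · have h2 : ({0, v.1, w.1} : Finset V).card ≤ 3 := Finset.card_le_three
      have h3 := eight_mul_card_filter hQ.nondegenerate v.2.1 w.2.1 (add_ne_zero_of_ne hvw')
        0 β β
      rw [v.2.2, w.2.2, binaryChar_zero, hcard, one_mul, mul_one, ← hSdef] at h3
      -- Five solutions leave two common neighbours after `0`, `v` and `w` are discarded.
      have h4 : (40 : ℤ) ≤ 8 * ((Finset.univ.filter fun u =>
          Q u = 0 ∧ polar Q v.1 u = β ∧ polar Q w.1 u = β).card : ℤ) := by
        rw [h3]
        rcases binaryChar_eq β with h | h <;> rcases binaryChar_eq (Q (v.1 + w.1)) with h' | h' <;>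
          rcases hS with hS | ⟨hS, h16⟩ <;> rw [h, h', hS] <;> nlinarith
      omega
    · intro u hu hE
      simp only [Finset.mem_filter, Finset.mem_univ, true_and] at hu
      simp only [Finset.mem_insert, Finset.mem_singleton, not_or] at hE
      refine ⟨⟨hE.1, hu.1⟩, ?_⟩
      rw [Finset.mem_inter, SimpleGraph.mem_neighborFinset, SimpleGraph.mem_neighborFinset]
      exact ⟨⟨fun h => hE.2.1 (congrArg Subtype.val h).symm, hu.2.1⟩,
        ⟨fun h => hE.2.2 (congrArg Subtype.val h).symm, hu.2.2⟩⟩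
  · intro s hs
    rcases s.eq_empty_or_nonempty with rfl | hne
    · rw [Finset.card_empty, zero_add]
      have : (Fintype.card {v : V // v ≠ 0 ∧ Q v = 0} : ℤ) ≤ 3 * k + 1 := by
        rcases binaryChar_eq β with h | h <;> rw [h] at hk <;>
          rcases hS with hS | ⟨hS, h16⟩ <;> rw [hS] at hk hn <;> nlinarith
      exact_mod_cast this
    set t := s.map (Function.Embedding.subtype _) with ht
    have htne : t.Nonempty := by simpa [ht] using hne
    have htc : t.card = s.card := Finset.card_map _
    have hindep : ∀ a ∈ t, ∀ b ∈ t, a ≠ b → polar Q a b ≠ β := by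
      intro a ha b hb hab hp
      obtain ⟨a, ha', rfl⟩ := Finset.mem_map.1 ha
      obtain ⟨b, hb', rfl⟩ := Finset.mem_map.1 hb
      exact hs a ha' b hb' ⟨fun h => hab (congrArg _ h), hp⟩
    suffices h : (s.card : ℤ) + Fintype.card {v : V // v ≠ 0 ∧ Q v = 0} ≤ 3 * k + 1 by
      exact_mod_cast h
    -- Independent sets have at most `x + 2` vertices for `β = 0` and at most `x` for `β = 1`. For
    -- `β = 1`, `S = x` the inequality is sharp at `x = 8`; for `β = 0`, `S = -x` it fails at `x =
    -- 8`, whence `16 ≤ x`.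
    rcases ZMod.eq_zero_or_eq_one β with rfl | rfl
    · have h := card_sub_two_sq_le_of_polar_eq_one hQ.nondegenerate htne fun a ha b hb hab =>
        (ZMod.eq_zero_or_eq_one _).resolve_left (hindep a ha b hb hab)
      rw [htc, hcard] at h
      have h1 : (s.card : ℤ) - 2 ≤ x := abs_le_of_sq_le_sq' h (by omega) |>.2
      rw [binaryChar_zero] at hk
      rcases hS with hS | ⟨hS, h16⟩ <;> rw [hS] at hk hn <;> nlinarith
    · have h := card_sq_le_of_polar_eq_zero hQ.nondegenerate htne fun a ha b hb => by
        rcases eq_or_ne a b with rfl | hab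
        · exact polar_self_eq_zero Q a
        · exact (ZMod.eq_zero_or_eq_one _).resolve_right (hindep a ha b hb hab)
      rw [htc, hcard] at h
      have h1 : (s.card : ℤ) ≤ x := abs_le_of_sq_le_sq' h (by omega) |>.2
      rw [binaryChar_one] at hk
      rcases hS with hS | ⟨hS, h16⟩ <;> rw [hS] at hk hn <;> nlinarith

variable (Q) in
/-- The singular `1`-space spanned by a nonzero singular vector. -/
def SingularOneSpace.ofVector (v : {v : V // v ≠ 0 ∧ Q v = 0}) : SingularOneSpace Q :=
  ⟨Submodule.span (ZMod 2) {v.1}, finrank_span_singleton v.2.1, fun w hw => by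
    obtain ⟨c, rfl⟩ := Submodule.mem_span_singleton.1 hw
    rw [QuadraticMap.map_smul, v.2.2, smul_zero]⟩

theorem SingularOneSpace.ofVector_bijective :
    Function.Bijective (SingularOneSpace.ofVector Q) := by
  constructor
  · intro v w h
    have hv : v.1 ∈ Submodule.span (ZMod 2) {w.1} := by
      have := congrArg Subtype.val h
      change Submodule.span (ZMod 2) {v.1} = Submodule.span (ZMod 2) {w.1} at this
      rw [← this]
      exact Submodule.mem_span_singleton_self _
    obtain ⟨c, hc⟩ := Submodule.mem_span_singleton.1 hv
    apply Subtype.ext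
    rcases ZMod.eq_zero_or_eq_one c with rfl | rfl
    · rw [zero_smul] at hc
      exact absurd hc.symm v.2.1
    · rw [← hc, one_smul]
  · rintro ⟨W, hW, hQW⟩
    obtain ⟨v, hv, hspan⟩ := finrank_eq_one_iff'.1 hW
    refine ⟨⟨v.1, fun h => hv (Subtype.ext h), hQW _ v.2⟩, Subtype.ext ?_⟩
    apply le_antisymm
    · exact (Submodule.span_singleton_le_iff_mem _ _).2 v.2
    · intro w hw
      obtain ⟨c, hc⟩ := hspan ⟨w, hw⟩
      exact Submodule.mem_span_singleton.2 ⟨c, congrArg Subtype.val hc⟩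

theorem SingularOneSpace.smul_ofVector (g : isometryGroup Q) (v : {v : V // v ≠ 0 ∧ Q v = 0}) :
    g • ofVector Q v = ofVector Q ⟨g.1 v.1, by simpa using v.2.1, (g.2 v.1).trans v.2.2⟩ := by
  apply Subtype.ext
  change Submodule.map _ (Submodule.span (ZMod 2) {v.1}) = Submodule.span (ZMod 2) {g.1 v.1}
  rw [Submodule.map_span, Set.image_singleton]
  rfl

theorem GaussSumSmall.isHamiltonian [Fintype V] (hQ : GaussSumSmall Q) {x : ℤ}
    (hcard : Fintype.card V = x ^ 2) (hx : 8 ≤ x)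
    (hS : ∑ v, binaryChar (Q v) = x ∨ ∑ v, binaryChar (Q v) = -x ∧ 16 ≤ x)
    {X : SimpleGraph (SingularOneSpace Q)} (hX : IsGeneralizedOrbitalGraph (POmega Q) X)
    (hne : X ≠ ⊥) : X.IsHamiltonian := by
  classical
  obtain ⟨y, z, hyz⟩ := SimpleGraph.ne_bot_iff_exists_adj.1 hne
  obtain ⟨a, rfl⟩ := SingularOneSpace.ofVector_bijective.2 y
  obtain ⟨b, rfl⟩ := SingularOneSpace.ofVector_bijective.2 z
  have hab : a.1 ≠ b.1 := by
    intro h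
    rw [Subtype.ext h] at hyz
    exact X.irrefl hyz
  -- By transitivity, `X` contains every pair whose inner product is that of the edge `a`, `b`.
  refine (hQ.isHamiltonian_singularGraph hcard hx hS (polar Q a.1 b.1)).of_bijective_hom
    ⟨SingularOneSpace.ofVector Q, fun {c d} hcd => ?_⟩ SingularOneSpace.ofVector_bijective
  obtain ⟨g, hg, hgc, hgd⟩ := hQ.exists_POmega_map_eq a.2.1 b.2.1 c.2.1 d.2.1 hab
    (fun h => hcd.1 (Subtype.ext h)) a.2.2 b.2.2 c.2.2 d.2.2 hcd.2.symm
  have h := hX.adj_smul hyz ⟨g, hg⟩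
  change X.Adj (g • SingularOneSpace.ofVector Q a) (g • SingularOneSpace.ofVector Q b) at h
  rw [SingularOneSpace.smul_ofVector, SingularOneSpace.smul_ofVector] at h
  convert h using 2
  · exact Subtype.ext hgc.symm
  · exact Subtype.ext hgd.symm

end Orthogonal

/-! ### The two standard forms and their Gauss sums. -/

namespace OrthSpace

open QuadraticMap

variable {d : ℕ}

theorem plusForm_apply (v : OrthSpace d) : plusForm d v = ∑ i, v.1 i * v.2 i := by
  simp [plusForm, xCoord, yCoord]

theorem polar_plusForm (v w : OrthSpace d) :
    polar (plusForm d) v w = ∑ i, (v.1 i * w.2 i + w.1 i * v.2 i) := by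
  rw [polar, plusForm_apply, plusForm_apply, plusForm_apply, ← Finset.sum_sub_distrib,
    ← Finset.sum_sub_distrib]
  refine Finset.sum_congr rfl fun i _ => ?_
  simp only [Prod.fst_add, Prod.snd_add, Pi.add_apply]
  ring

theorem exists_polar_plusForm_eq_one (v : OrthSpace d) (hv : v ≠ 0) :
    ∃ w, polar (plusForm d) v w = 1 := by
  by_cases h1 : v.1 = 0
  · have h2 : v.2 ≠ 0 := fun h2 => hv (Prod.ext h1 h2)
    obtain ⟨i, hi⟩ := Function.ne_iff.1 h2
    refine ⟨(Pi.single i 1, 0), ?_⟩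
    rw [polar_plusForm, Finset.sum_eq_single i]
    · simpa using (ZMod.eq_zero_or_eq_one _).resolve_left hi
    · intro j _ hj
      simp [hj]
    · simp
  · obtain ⟨i, hi⟩ := Function.ne_iff.1 h1
    refine ⟨(0, Pi.single i 1), ?_⟩
    rw [polar_plusForm, Finset.sum_eq_single i]
    · simpa using (ZMod.eq_zero_or_eq_one _).resolve_left hi
    · intro j _ hj
      simp [hj]
    · simp

theorem binaryChar_sum {ι : Type*} (s : Finset ι) (f : ι → ZMod 2) :
    binaryChar (∑ i ∈ s, f i) = ∏ i ∈ s, binaryChar (f i) := by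
  classical
  induction s using Finset.induction_on with
  | empty => simp [binaryChar_zero]
  | insert a s ha ih => rw [Finset.sum_insert ha, Finset.prod_insert ha, binaryChar_add, ih]

theorem sum_binaryChar_plusForm : ∑ v, binaryChar (plusForm d v) = 2 ^ d := by
  have h1 : ∀ t : ZMod 2, ∑ u, binaryChar (t * u) = if t = 0 then 2 else 0 := by decide
  simp only [plusForm_apply, binaryChar_sum]
  rw [Fintype.sum_prod_type]
  simp only
  -- For fixed `x` the sum over `y` factors over the coordinates and vanishes unless `x = 0`.
  have h2 : ∀ x : Fin d → ZMod 2, ∑ y : Fin d → ZMod 2, ∏ i, binaryChar (x i * y i) =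
      ∏ i, (if x i = 0 then 2 else 0 : ℤ) := by
    intro x
    rw [← Finset.prod_congr rfl fun i _ => h1 (x i)]
    exact (Fintype.prod_sum fun i u => binaryChar (x i * u)).symm
  simp only [h2]
  rw [← Fintype.prod_sum fun (_ : Fin d) (t : ZMod 2) => (if t = 0 then 2 else 0 : ℤ)]
  simp [show (∑ t : ZMod 2, if t = 0 then 2 else 0 : ℤ) = 2 by decide]

theorem card_orthSpace : (Fintype.card (OrthSpace d) : ℤ) = (2 ^ d) ^ 2 := by
  simp [OrthSpace, ZMod.card]
  ring

/-- The sum of the first two basis vectors. -/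
def shiftVector (d : ℕ) : OrthSpace d :=
  (fun i => if i.val = 0 then 1 else 0, fun i => if i.val = 0 then 1 else 0)

/-- Squares are linear over `GF(2)`, so the added term is a linear form, hence the pairing with a
vector. The minus form thus has the same polar form, and its Gauss sum is a twisted sum for the plus
form. -/
theorem minusForm_apply (v : OrthSpace d) :
    minusForm d v = plusForm d v + polar (plusForm d) (shiftVector d) v := by
  have hsq : ∀ t : ZMod 2, t * t = t := by decide
  rw [minusForm, _root_.add_apply, _root_.sum_apply, polar_plusForm]
  congr 1
  rw [Finset.sum_filter]
  refine Finset.sum_congr rfl fun i _ => ?_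
  by_cases hi : i.val = 0
  · simp [hi, shiftVector, xCoord, yCoord, hsq, add_comm]
  · simp [hi, shiftVector]

theorem polar_minusForm (v w : OrthSpace d) :
    polar (minusForm d) v w = polar (plusForm d) v w := by
  rw [polar, minusForm_apply, minusForm_apply, minusForm_apply, polar_add_right]
  change _ = plusForm d (v + w) - plusForm d v - plusForm d w
  ring

theorem plusForm_shiftVector (hd : 0 < d) : plusForm d (shiftVector d) = 1 := by
  rw [plusForm_apply, Finset.sum_eq_single ⟨0, hd⟩]
  · simp [shiftVector]
  · intro i _ hi
    have : i.val ≠ 0 := fun h => hi (Fin.ext h)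
    simp [shiftVector, this]
  · simp

theorem sum_binaryChar_minusForm (hd : 0 < d) :
    ∑ v, binaryChar (minusForm d v) = -2 ^ d := by
  simp only [minusForm_apply, binaryChar_add]
  rw [sum_binaryChar_mul_polar, plusForm_shiftVector hd, binaryChar_one, sum_binaryChar_plusForm]
  ring

theorem isHamiltonian_of_isGeneralizedOrbitalGraph_plusForm (hd : 3 ≤ d)
    {X : SimpleGraph (SingularOneSpace (plusForm d))}
    (hX : IsGeneralizedOrbitalGraph (POmega (plusForm d)) X) (hne : X ≠ ⊥) :
    X.IsHamiltonian := by
  have hx : (8 : ℤ) ≤ 2 ^ d := by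
    calc (8 : ℤ) = 2 ^ 3 := by norm_num
      _ ≤ 2 ^ d := pow_le_pow_right₀ (by norm_num) hd
  have hQ : GaussSumSmall (plusForm d) := by
    refine ⟨exists_polar_plusForm_eq_one, ?_, ?_⟩ <;>
      rw [sum_binaryChar_plusForm, card_orthSpace] <;> nlinarith
  exact hQ.isHamiltonian card_orthSpace hx (Or.inl sum_binaryChar_plusForm) hX hne

theorem isHamiltonian_of_isGeneralizedOrbitalGraph_minusForm (hd : 4 ≤ d)
    {X : SimpleGraph (SingularOneSpace (minusForm d))}
    (hX : IsGeneralizedOrbitalGraph (POmega (minusForm d)) X) (hne : X ≠ ⊥) :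
    X.IsHamiltonian := by
  have hx : (16 : ℤ) ≤ 2 ^ d := by
    calc (16 : ℤ) = 2 ^ 4 := by norm_num
      _ ≤ 2 ^ d := pow_le_pow_right₀ (by norm_num) hd
  have hS := sum_binaryChar_minusForm (d := d) (by omega)
  have hQ : GaussSumSmall (minusForm d) := by
    refine ⟨fun v hv => ?_, ?_, ?_⟩
    · simpa only [polar_minusForm] using exists_polar_plusForm_eq_one v hv
    all_goals
      rw [hS, card_orthSpace]
      nlinarith
  exact hQ.isHamiltonian card_orthSpace (by omega) (Or.inr ⟨hS, hx⟩) hX hne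

theorem three_le_of_lt {d : ℕ} (h : 2 ^ (d - 1) + 1 < 2 ^ d - 1) : 3 ≤ d := by
  by_contra! hd
  interval_cases d <;> simp at h

/-- For `d ≤ 2` the number `2^(d-1) - 1` is `0` or `1`, and for `d = 3` the number `2^d + 1` is `9`.
-/
theorem four_le_of_prime {d : ℕ} (hp : (2 ^ d + 1).Prime) (hq : (2 ^ (d - 1) - 1).Prime) :
    4 ≤ d := by
  by_contra! hd
  interval_cases d <;> revert hp hq <;> norm_num

end OrthSpace

/-! ### Hamilton cycles from explicit lists. -/

theorem SimpleGraph.isHamiltonian_of_isChain {α β : Type*} [Fintype β] [DecidableEq β]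
    {G : SimpleGraph β} {val : β → α} {r : α → α → Prop}
    (hr : ∀ a b, r (val a) (val b) → G.Adj a b) {l : List α} (hl : ∀ a ∈ l, a ∈ Set.range val)
    (hn : l.Nodup) (hc : (l ++ l.take 1).IsChain r) (h3 : 3 ≤ l.length)
    (hcard : l.length = Fintype.card β) : G.IsHamiltonian := by
  obtain ⟨l, rfl⟩ : l ∈ Set.range (List.map val) := by rwa [Set.range_list_map]
  -- The junction of `l` with `l.take 1` is the closing edge.
  rw [List.isChain_append, List.isChain_map] at hc
  rw [List.length_map] at h3 hcard
  refine isHamiltonian_of_isCycleList ⟨hn.of_map, hc.1.imp fun a b => hr a b, fun a ha b hb => ?_⟩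
    h3 hcard
  refine hr a b (hc.2.2 _ ?_ _ ?_)
  · rw [List.getLast?_map]
    exact Option.mem_map_of_mem _ ha
  · rw [List.head?_take, if_neg one_ne_zero, List.head?_map]
    exact Option.mem_map_of_mem _ hb

/-! ### The alternating group on triples. -/

namespace Triple

open scoped Pointwise

/-- The set of the positions of the digits `1` of a number written in base two. -/
def ofMask (m : ℕ) : Finset (Fin 7) := Finset.univ.filter fun i => m.testBit i

/-- For `k ≤ 2`, a cyclic enumeration of the triples in which consecutive triples meet in `k`
points. -/
def cycle : ℕ → List ℕ
  | 0 => [7, 88, 38, 81, 14, 97, 28, 35, 76, 49, 74, 21, 42, 84, 41, 70, 25, 98, 13, 50, 69, 56,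
      67, 44, 82, 37, 26, 100, 19, 104, 22, 73, 52, 11, 112]
  | 1 => [7, 49, 67, 41, 112, 73, 14, 84, 26, 104, 69, 74, 50, 70, 28, 100, 21, 35, 44, 22, 37, 19,
      97, 13, 56, 82, 38, 11, 76, 81, 98, 88, 52, 42, 25]
  | _ => [7, 21, 28, 52, 100, 84, 112, 88, 104, 76, 73, 97, 37, 69, 81, 67, 74, 98, 50, 42, 44, 13,
      14, 38, 35, 41, 56, 49, 19, 11, 25, 26, 82, 70, 22]

theorem cycle_spec : ∀ k < 3, (∀ s ∈ (cycle k).map ofMask, s.card = 3) ∧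
    ((cycle k).map ofMask).Nodup ∧ ((cycle k).map ofMask).length = 35 ∧
    ((cycle k).map ofMask ++ ((cycle k).map ofMask).take 1).IsChain
      (fun s t => (s ∩ t).card = k) := by
  decide +kernel

/-- The alternating group is transitive on the pairs of triples that meet in a given number of
points. -/
theorem exists_smul_eq {s t s' t' : Finset (Fin 7)} (hs : s.card = 3) (ht : t.card = 3)
    (hs' : s'.card = 3) (ht' : t'.card = 3) (h : (s ∩ t).card = (s' ∩ t').card) :
    ∃ g ∈ alternatingGroup (Fin 7), g • s = s' ∧ g • t = t' := by
  set f : Fin 7 → Bool × Bool := fun x => (decide (x ∈ s), decide (x ∈ t)) with hf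
  set f' : Fin 7 → Bool × Bool := fun x => (decide (x ∈ s'), decide (x ∈ t')) with hf'
  -- With `k` common points the four fibres have sizes `k`, `3 - k`, `3 - k` and `1 + k`; matching
  -- them gives a permutation.
  have hfib : ∀ c, Fintype.card {a // f a = c} = Fintype.card {a // f' a = c} := by
    have aux : ∀ u v : Finset (Fin 7), u.card = 3 → v.card = 3 → ∀ c : Bool × Bool,
        Fintype.card {a // (decide (a ∈ u), decide (a ∈ v)) = c} =
          if c = (true, true) then (u ∩ v).card
          else if c = (false, false) then 1 + (u ∩ v).card else 3 - (u ∩ v).card := by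
      intro u v hu hv c
      have e1 := Finset.card_inter_add_card_sdiff u v
      have e2 := Finset.card_inter_add_card_sdiff v u
      have e3 := Finset.card_union_add_card_inter u v
      have e4 := Finset.card_compl_add_card (u ∪ v)
      rw [Fintype.card_fin] at e4
      rw [Finset.inter_comm v u] at e2
      rw [Fintype.card_subtype]
      rcases c with ⟨_ | _, _ | _⟩
      · have : (Finset.univ.filter fun a => (decide (a ∈ u), decide (a ∈ v)) = (false, false)) =
            (u ∪ v)ᶜ := by ext; simp
        rw [this, if_neg (by decide), if_pos rfl]; omega
      · have : (Finset.univ.filter fun a => (decide (a ∈ u), decide (a ∈ v)) = (false, true)) =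
            v \ u := by ext; simp [and_comm]
        rw [this]; simp; omega
      · have : (Finset.univ.filter fun a => (decide (a ∈ u), decide (a ∈ v)) = (true, false)) =
            u \ v := by ext; simp
        rw [this]; simp; omega
      · have : (Finset.univ.filter fun a => (decide (a ∈ u), decide (a ∈ v)) = (true, true)) =
            u ∩ v := by ext; simp
        rw [this]; simp
    intro c
    rw [aux s t hs ht, aux s' t' hs' ht', h]
  set σ : Equiv.Perm (Fin 7) :=
    Equiv.ofFiberEquiv fun c => Fintype.equivOfCardEq (hfib c) with hσ
  have hσf : ∀ a, f' (σ a) = f a := fun a => Equiv.ofFiberEquiv_map _ a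
  obtain ⟨g, hg, hgf⟩ : ∃ g ∈ alternatingGroup (Fin 7), ∀ a, f' (g a) = f a := by
    rcases Int.units_eq_one_or (Equiv.Perm.sign σ) with h1 | h1
    · exact ⟨σ, Equiv.Perm.mem_alternatingGroup.2 h1, hσf⟩
    -- Seven points in four fibres: two points share a fibre, and swapping them repairs the sign.
    · obtain ⟨i, j, hij, hfij⟩ := Fintype.exists_ne_map_eq_of_card_lt f (by decide)
      refine ⟨σ * Equiv.swap i j, ?_, fun a => ?_⟩
      · rw [Equiv.Perm.mem_alternatingGroup, Equiv.Perm.sign_mul, h1, Equiv.Perm.sign_swap hij]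
        decide
      · rw [Equiv.Perm.mul_apply, hσf]
        rcases eq_or_ne a i with rfl | hai
        · rw [Equiv.swap_apply_left, hfij]
        rcases eq_or_ne a j with rfl | haj
        · rw [Equiv.swap_apply_right, hfij]
        · rw [Equiv.swap_apply_of_ne_of_ne hai haj]
  have hmem : ∀ a, (g a ∈ s' ↔ a ∈ s) ∧ (g a ∈ t' ↔ a ∈ t) := by
    intro a
    have := hgf a
    simpa [hf, hf', Prod.ext_iff] using this
  refine ⟨g, hg, ?_, ?_⟩
  · ext x
    rw [← Finset.inv_smul_mem_iff, ← (hmem (g⁻¹ • x)).1, ← Equiv.Perm.smul_def, smul_inv_smul]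
  · ext x
    rw [← Finset.inv_smul_mem_iff, ← (hmem (g⁻¹ • x)).2, ← Equiv.Perm.smul_def, smul_inv_smul]

theorem isHamiltonian_of_isGeneralizedOrbitalGraph
    {X : SimpleGraph (Set.powersetCard (Fin 7) 3)}
    (hX : IsGeneralizedOrbitalGraph (alternatingGroup (Fin 7)) X) (hne : X ≠ ⊥) :
    X.IsHamiltonian := by
  obtain ⟨s, t, hst⟩ := SimpleGraph.ne_bot_iff_exists_adj.1 hne
  have hk : (s.1 ∩ t.1).card < 3 := by
    refine lt_of_le_of_ne ((Finset.card_le_card Finset.inter_subset_left).trans s.2.le) fun h => ?_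
    have h1 : s.1 ∩ t.1 = s.1 :=
      Finset.eq_of_subset_of_card_le Finset.inter_subset_left (s.2.le.trans h.ge)
    have h2 : s.1 ∩ t.1 = t.1 :=
      Finset.eq_of_subset_of_card_le Finset.inter_subset_right (t.2.le.trans h.ge)
    have h3 : s = t := Subtype.ext (h1.symm.trans h2)
    exact X.irrefl (h3 ▸ hst)
  obtain ⟨h1, h2, h3, h4⟩ := cycle_spec _ hk
  refine SimpleGraph.isHamiltonian_of_isChain (val := Subtype.val) (fun a b hab => ?_)
    (fun a ha => ⟨⟨a, h1 a ha⟩, rfl⟩) h2 h4 (by omega)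
    (h3.trans ?_)
  · obtain ⟨g, hg, hgs, hgt⟩ := exists_smul_eq s.2 t.2 a.2 b.2 hab.symm
    have := hX.adj_smul hst ⟨g, hg⟩
    convert this using 1
    · exact Subtype.ext hgs.symm
    · exact Subtype.ext hgt.symm
  · have := Set.powersetCard.card (α := Fin 7) (n := 3)
    rw [Nat.card_eq_fintype_card] at this
    rw [this]
    simp [Nat.choose]

end Triple

/-! ### The Golay code in echelon form and the list of the hexads. -/

namespace Mathieu

open scoped Pointwise

/-- The number of a point: `23` for `∞`, and the residue of `z` for `z` in `GF(23)`. -/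
def index : Point → ℕ
  | none => 23
  | some z => z.val

/-- The point with a given number. -/
def point (i : ℕ) : Point := if i = 23 then none else some (i : ZMod 23)

theorem index_lt (z : Point) : index z < 24 := by
  revert z; decide +kernel

theorem point_index (z : Point) : point (index z) = z := by
  revert z; decide +kernel

theorem index_point : ∀ i < 24, index (point i) = i := by
  decide +kernel

/-- The set of the points whose numbers are the positions of the digits `1` of `m` in base two. -/
def ofMask (m : ℕ) : Finset Point := Finset.univ.filter fun z => m.testBit (index z)

theorem mem_ofMask {m : ℕ} {z : Point} : z ∈ ofMask m ↔ m.testBit (index z) = true := by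
  simp [ofMask]

/-- The number of digits `1` among the last 24 digits in base two. -/
def weight (m : ℕ) : ℕ := ((Finset.range 24).filter fun i => m.testBit i).card

theorem card_ofMask (m : ℕ) : (ofMask m).card = weight m := by
  have h : ofMask m = ((Finset.range 24).filter fun i => m.testBit i).image point := by
    ext z
    simp only [mem_ofMask, Finset.mem_image, Finset.mem_filter, Finset.mem_range]
    constructor
    · exact fun hz => ⟨index z, ⟨index_lt z, hz⟩, point_index z⟩
    · rintro ⟨i, ⟨hi, hm⟩, rfl⟩
      rwa [index_point i hi]
  rw [h, Finset.card_image_of_injOn]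
  · rfl
  · intro i hi j hj hij
    simp only [Finset.coe_filter, Finset.mem_range, Set.mem_ofPred_eq] at hi hj
    rw [← index_point i hi.1, ← index_point j hj.1, hij]

theorem ofMask_inter (m n : ℕ) : ofMask m ∩ ofMask n = ofMask (m &&& n) := by
  ext z
  simp [mem_ofMask]

theorem ofMask_injOn {m n : ℕ} (hm : m < 2 ^ 24) (hn : n < 2 ^ 24) (h : ofMask m = ofMask n) :
    m = n := by
  refine Nat.eq_of_testBit_eq fun i => ?_
  rcases lt_or_ge i 24 with hi | hi
  · have := Finset.ext_iff.1 h (point i)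
    rw [mem_ofMask, mem_ofMask, index_point i hi] at this
    exact Bool.eq_iff_iff.2 this
  · rw [Nat.testBit_lt_two_pow (hm.trans_le (Nat.pow_le_pow_right two_pos hi)),
      Nat.testBit_lt_two_pow (hn.trans_le (Nat.pow_le_pow_right two_pos hi))]

/-- The digit of `m` at the position `i` in base two, as an element of `GF(2)`. -/
def bit (m i : ℕ) : ZMod 2 := if m.testBit i then 1 else 0

theorem bit_zero (i : ℕ) : bit 0 i = 0 := by simp [bit]

theorem bit_xor (m n i : ℕ) : bit (m ^^^ n) i = bit m i + bit n i := by
  simp only [bit, Nat.testBit_xor]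
  cases m.testBit i <;> cases n.testBit i <;> decide

/-- The sum of a list of masks. -/
def xorSum (l : List ℕ) : ℕ := l.foldr (· ^^^ ·) 0

theorem bit_xorSum (l : List ℕ) (i : ℕ) : bit (xorSum l) i = (l.map fun m => bit m i).sum := by
  induction l with
  | nil => exact bit_zero i
  | cons a l ih => rw [List.map_cons, List.sum_cons, ← ih, ← bit_xor]; rfl

/-- All sums of sublists of a list of masks. -/
def spanList (l : List ℕ) : List ℕ := l.foldr (fun a s => s ++ s.map (a ^^^ ·)) [0]

theorem xorSum_ite_mem_spanList (P : ℕ → Prop) [DecidablePred P] (f : ℕ → ℕ) (l : List ℕ) :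
    xorSum (l.map fun k => if P k then f k else 0) ∈ spanList (l.map f) := by
  induction l with
  | nil => simp [xorSum, spanList]
  | cons a l ih =>
    have h1 : spanList ((a :: l).map f) =
      spanList (l.map f) ++ (spanList (l.map f)).map (f a ^^^ ·) := rfl
    have h2 : xorSum ((a :: l).map fun k => if P k then f k else 0) =
      (if P a then f a else 0) ^^^ xorSum (l.map fun k => if P k then f k else 0) := rfl
    rw [h1, h2, List.mem_append]
    by_cases ha : P a
    · right
      rw [if_pos ha]
      exact List.mem_map_of_mem ih
    · left
      rwa [if_neg ha, Nat.zero_xor]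

theorem card_inter_ofMask (s : Finset Point) (m : ℕ) :
    ((s ∩ ofMask m).card : ZMod 2) = ∑ z ∈ s, bit m (index z) := by
  rw [← Finset.filter_mem_eq_inter, Finset.card_filter]
  push_cast
  exact Finset.sum_congr rfl fun z _ => by simp [mem_ofMask, bit]

theorem even_card_inter_xorSum {s : Finset Point} {l : List ℕ}
    (h : ∀ m ∈ l, Even (s ∩ ofMask m).card) : Even (s ∩ ofMask (xorSum l)).card := by
  rw [← ZMod.natCast_eq_zero_iff_even, card_inter_ofMask]
  induction l with
  | nil => exact Finset.sum_eq_zero fun z _ => bit_zero _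
  | cons a l ih =>
    have h1 : xorSum (a :: l) = a ^^^ xorSum l := rfl
    simp only [h1, bit_xor, Finset.sum_add_distrib]
    rw [ih fun m hm => h m (List.mem_cons_of_mem a hm), add_zero, ← card_inter_ofMask,
      ZMod.natCast_eq_zero_iff_even]
    exact h a List.mem_cons_self

/-- The masks of the sets `checkSet i`. -/
def checkMasks : List ℕ :=
  [16436384, 16095553, 15413891, 14050567, 11323919, 14259230, 11741245, 15093882, 13410549,
    10043883, 11699158, 15009708, 13242201, 9707187, 11025766, 13662924, 10548633, 12708658,
    8640101, 8891594, 9394580, 10400552, 12412496]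

/-- Parity checks that are in echelon form at the positions `0, …, 11`. -/
def rowMasks : List ℕ :=
  [13062145, 4845570, 13938692, 7221256, 10170384, 11952160, 15515712, 2019456, 4038912, 8077824,
    11654144, 14919680]

/-- The sets `checkSet i` that add up to the parity checks in `rowMasks`. -/
def rowSources : List (List ℕ) :=
  [[1, 3, 6, 10, 11], [0, 1, 3, 4, 5, 6, 7, 8, 9, 11], [0, 3, 4, 7, 10], [3, 4, 5, 6, 8, 10],
    [1, 3, 4, 5, 7, 9, 10], [2, 4, 5, 6, 8, 10, 11], [0, 2, 3, 6, 7, 8, 10], [4, 6, 7, 8, 9, 10],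
    [5, 7, 8, 9, 10, 11], [0, 2, 5, 6], [7, 10, 11], [0, 2, 5, 9, 10]]

/-- A basis of the code that is in echelon form at the positions `12, …, 23`. -/
def columnMasks : List ℕ :=
  [5279, 10558, 18147, 36294, 69395, 133817, 262637, 525274, 1050548, 2101096, 4196943, 8391797]

/-- A cyclic enumeration of the hexads in which consecutive hexads are disjoint. -/
def disjointCycle : List ℕ :=
  [958466, 6358592, 1574938, 6562176, 230424, 1077378, 4358468, 2711560, 1218592, 287300,
    5248272, 328330, 1721408, 2168976, 1581348, 2278016, 274488, 2621638, 4262184, 3186768,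
    4673536, 9546, 1441940, 2107938, 577556, 205024, 1082886, 805024, 3342594, 4199076, 2492488,
    4252704, 3936768, 3188, 6328330, 723460, 4210904, 395040, 5865600, 268550, 1131056, 4732992,
    33202, 1387520, 557672, 83332, 5382664, 116802, 659848, 4268054, 24072, 2457636, 534160,
    2117984, 4981772, 157968, 300224, 4735746, 3146920, 111360, 2376722, 1051584, 594978, 43148,
    852304, 2241540, 5505122, 2097948, 4328578, 1360136, 6946864, 1118284, 4491792, 147502,
    2657536, 135762, 7358468]

/-- A cyclic enumeration of the hexads in which consecutive hexads meet in two points. -/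
def pairCycle : List ℕ :=
  [958466, 1082886, 2376722, 2492488, 6358592, 135762, 2117984, 4732992, 4252704, 7358468,
    1581348, 805024, 4262184, 4981772, 4673536, 1360136, 3146920, 1051584, 1574938, 1077378,
    6562176, 274488, 5248272, 659848, 268550, 2097948, 5382664, 147502, 33202, 116802, 328330,
    9546, 594978, 4735746, 3342594, 4358468, 3188, 300224, 287300, 205024, 723460, 83332,
    2711560, 2657536, 4491792, 534160, 395040, 2457636, 43148, 6328330, 2278016, 4328578,
    1441940, 1218592, 1387520, 3186768, 6946864, 4199076, 557672, 4210904, 230424, 2168976,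
    24072, 111360, 2241540, 577556, 2621638, 1118284, 4268054, 852304, 3936768, 1131056, 157968,
    1721408, 5865600, 5505122, 2107938]

/-- The multiplication by two on the projective line. -/
def doubling : List ℕ :=
  [0, 2, 4, 6, 8, 10, 12, 14, 16, 18, 20, 22, 1, 3, 5, 7, 9, 11, 13, 15, 17, 19, 21, 23]

/-- An element of order five of the stabilizer of a hexad. -/
def quintic : List ℕ :=
  [0, 17, 3, 21, 2, 6, 20, 22, 8, 4, 16, 12, 7, 1, 11, 15, 5, 18, 19, 13, 10, 9, 14, 23]

/-- An involution in the stabilizer of a hexad. -/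
def involution : List ℕ :=
  [0, 13, 2, 3, 16, 7, 8, 5, 6, 12, 10, 14, 9, 1, 11, 17, 4, 15, 18, 19, 21, 20, 22, 23]

theorem checkSet_eq (i : ZMod 23) : checkSet i = ofMask (checkMasks.getD i.val 0) := by
  revert i; decide +kernel

theorem rowMasks_eq : rowMasks = rowSources.map fun l => xorSum (l.map (checkMasks.getD · 0)) := by
  decide +kernel

/-- The sum of the parity checks in `rowMasks` that agrees with `m` at the positions
`0, …, 11`. -/
def rowCombination (m : ℕ) : List ℕ :=
  ((List.range 12).filter fun j => m.testBit j).map (rowMasks.getD · 0)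

theorem checkMasks_eq : ∀ m ∈ checkMasks, xorSum (rowCombination m) = m := by
  decide +kernel

theorem rowCombination_subset (m : ℕ) : ∀ n ∈ rowCombination m, n ∈ rowMasks := by
  intro n hn
  obtain ⟨j, hj, rfl⟩ := List.mem_map.1 hn
  have hj' : j < 12 := List.mem_range.1 (List.mem_filter.1 hj).1
  rw [List.getD_eq_getElem _ _ (show j < rowMasks.length from hj')]
  exact List.getElem_mem _

/-- The two lists of parity checks span each other, and parity of the intersection is additive in
the mask. -/
theorem mem_golayCode_iff {s : Finset Point} :
    s ∈ golayCode ↔ ∀ m ∈ rowMasks, Even (s ∩ ofMask m).card := by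
  constructor
  · intro h m hm
    rw [rowMasks_eq] at hm
    obtain ⟨l, -, rfl⟩ := List.mem_map.1 hm
    refine even_card_inter_xorSum fun n hn => ?_
    obtain ⟨i, -, rfl⟩ := List.mem_map.1 hn
    rcases lt_or_ge i 23 with hi | hi
    · have := h (i : ZMod 23)
      rwa [checkSet_eq, ZMod.val_natCast_of_lt hi] at this
    -- The default mask `0` is the empty set.
    · rw [List.getD_eq_default _ _ hi]
      simp [ofMask]
  · intro h i
    have hi : i.val < checkMasks.length := ZMod.val_lt i
    rw [checkSet_eq, List.getD_eq_getElem _ _ hi, ← checkMasks_eq _ (List.getElem_mem hi)]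
    exact even_card_inter_xorSum fun n hn => h n (rowCombination_subset _ n hn)

/-- In matrix form the two lists are `[I | A]` and `[Aᵀ | I]`. -/
theorem columnMasks_eq : ∀ k < 12, ∀ i < 12,
    bit (rowMasks.getD i 0) (12 + k) = bit (columnMasks.getD k 0) i ∧
      bit (rowMasks.getD i 0) k = (if k = i then 1 else 0) ∧
      bit (columnMasks.getD k 0) (12 + i) = if k = i then 1 else 0 := by
  decide +kernel

/-- The parity check number `i` expresses the coordinate `i < 12` through the last twelve
coordinates, with the coefficients recorded in `columnMasks`. -/
theorem eq_ofMask_of_mem_golayCode {s : Finset Point} (hs : s ∈ golayCode) :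
    s = ofMask (xorSum ((List.range 12).map fun k =>
      if point (12 + k) ∈ s then columnMasks.getD k 0 else 0)) := by
  set v : ℕ → ZMod 2 := fun i => if point i ∈ s then 1 else 0 with hv
  set m := xorSum ((List.range 12).map fun k =>
      if point (12 + k) ∈ s then columnMasks.getD k 0 else 0) with hm
  have hbit : ∀ i, bit m i = ∑ k ∈ Finset.range 12, v (12 + k) * bit (columnMasks.getD k 0) i := by
    intro i
    rw [hm, bit_xorSum, List.map_map, Finset.sum_eq_multiset_sum, Finset.range_val,
      Multiset.range, Multiset.map_coe, Multiset.sum_coe]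
    refine congrArg List.sum (List.map_congr_left fun k _ => ?_)
    by_cases h : point (12 + k) ∈ s
    · simp [hv, h]
    · simp [hv, h, bit_zero]
  have hsum : ∀ n, ((s ∩ ofMask n).card : ZMod 2) = ∑ i ∈ Finset.range 24, v i * bit n i := by
    intro n
    rw [card_inter_ofMask]
    have : s = ((Finset.range 24).filter fun i => point i ∈ s).image point := by
      ext z
      simp only [Finset.mem_image, Finset.mem_filter, Finset.mem_range]
      constructor
      · exact fun hz => ⟨index z, ⟨index_lt z, by rwa [point_index]⟩, point_index z⟩
      · rintro ⟨i, ⟨-, hi⟩, rfl⟩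
        exact hi
    conv_lhs => rw [this]
    rw [Finset.sum_image, Finset.sum_filter]
    · refine Finset.sum_congr rfl fun i hi => ?_
      rw [index_point i (Finset.mem_range.1 hi)]
      simp [hv]
    · intro i hi j hj hij
      simp only [Finset.coe_filter, Finset.mem_range, Set.mem_ofPred_eq] at hi hj
      rw [← index_point i hi.1, ← index_point j hj.1, hij]
  have hkey : ∀ i < 24, v i = bit m i := by
    intro i hi
    rw [hbit]
    rcases lt_or_ge i 12 with h | h
    · have h1 := mem_golayCode_iff.1 hs (rowMasks.getD i 0) (by
        rw [List.getD_eq_getElem _ _ (show i < rowMasks.length from h)]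
        exact List.getElem_mem _)
      rw [← ZMod.natCast_eq_zero_iff_even, hsum, Finset.sum_range_add _ 12 12,
        Finset.sum_eq_single i] at h1
      · rw [(columnMasks_eq i h i h).2.1, if_pos rfl, mul_one, ← ZModModule.sub_eq_add,
          sub_eq_zero] at h1
        rw [h1]
        refine Finset.sum_congr rfl fun k hk => ?_
        rw [(columnMasks_eq k (Finset.mem_range.1 hk) i h).1]
      · intro k hk hki
        rw [(columnMasks_eq k (Finset.mem_range.1 hk) i h).2.1, if_neg hki, mul_zero]
      · exact fun hn => absurd (Finset.mem_range.2 h) hn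
    · obtain ⟨j, rfl⟩ := Nat.exists_eq_add_of_le h
      have hj : j < 12 := by omega
      rw [Finset.sum_eq_single j]
      · rw [(columnMasks_eq j hj j hj).2.2, if_pos rfl, mul_one]
      · intro k hk hkj
        rw [(columnMasks_eq k (Finset.mem_range.1 hk) j hj).2.2, if_neg hkj, mul_zero]
      · exact fun hn => absurd (Finset.mem_range.2 hj) hn
  ext z
  have h := hkey (index z) (index_lt z)
  simp only [hv, bit, point_index] at h
  rw [mem_ofMask]
  by_cases h1 : z ∈ s <;> by_cases h2 : m.testBit (index z) = true <;> simp_all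

/-- The property that defines the hexads. -/
def IsHexad (h : Finset Point) : Prop :=
  none ∉ h ∧ some 0 ∉ h ∧ h.card = 6 ∧ insert none (insert (some 0) h) ∈ golayCode

/-- The mask of the octad that consists of a hexad and the two points `∞` and `0`. -/
def octadMask (m : ℕ) : ℕ := m ||| 8388609

theorem ofMask_octadMask (m : ℕ) :
    ofMask (octadMask m) = insert none (insert (some 0) (ofMask m)) := by
  -- `8388609 = 2^23 + 2^0`, and `∞` has number `23`.
  have h : ∀ z, Nat.testBit 8388609 (index z) = decide (z = none ∨ z = some 0) := by
    decide +kernel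
  ext z
  rw [mem_ofMask, octadMask, Nat.testBit_or, h, Finset.mem_insert, Finset.mem_insert, mem_ofMask,
    Bool.or_eq_true, decide_eq_true_eq]
  tauto

/-- A test for masks of hexads. -/
def isHexadMask (m : ℕ) : Bool :=
  !m.testBit 23 && !m.testBit 0 && weight m == 6 &&
    rowMasks.all fun n => weight (octadMask m &&& n) % 2 == 0

theorem isHexad_of_isHexadMask {m : ℕ} (h : isHexadMask m = true) : IsHexad (ofMask m) := by
  simp only [isHexadMask, Bool.and_eq_true, Bool.not_eq_true', beq_iff_eq, List.all_eq_true] at h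
  obtain ⟨⟨⟨h1, h2⟩, h3⟩, h4⟩ := h
  refine ⟨?_, ?_, ?_, ?_⟩
  · rw [mem_ofMask]
    exact fun h => by rw [show index none = 23 from rfl, h1] at h; exact absurd h (by decide)
  · rw [mem_ofMask]
    exact fun h => by rw [show index (some 0) = 0 from rfl, h2] at h; exact absurd h (by decide)
  · rw [card_ofMask, h3]
  · rw [← ofMask_octadMask, mem_golayCode_iff]
    intro n hn
    rw [ofMask_inter, card_ofMask, Nat.even_iff]
    exact h4 n hn

theorem isHexad_ofMask_of_mem : ∀ m ∈ disjointCycle ++ pairCycle, IsHexad (ofMask m) := by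
  have h : ∀ m ∈ disjointCycle ++ pairCycle, isHexadMask m = true := by decide +kernel
  exact fun m hm => isHexad_of_isHexadMask (h m hm)

/-- A search through all `2^12` sums of basis words; this is what makes the list of hexads complete.
-/
theorem mem_disjointCycle_of_mem_spanList : ∀ m ∈ spanList columnMasks,
    m.testBit 23 → m.testBit 0 → weight m = 8 → m ∈ disjointCycle.map octadMask := by
  have h : ((spanList columnMasks).all fun m => !m.testBit 23 || (!m.testBit 0 ||
      (!(weight m == 8) || (disjointCycle.map octadMask).contains m))) = true := by
    decide +kernel
  intro m hm h1 h2 h3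
  simpa [h1, h2, h3] using List.all_eq_true.1 h m hm

theorem mem_map_disjointCycle {h : Finset Point} (hh : IsHexad h) :
    ∃ m ∈ disjointCycle, ofMask m = h := by
  obtain ⟨h1, h2, h3, h4⟩ := hh
  have h5 : none ∉ insert (some 0) h := by simpa using h1
  set m := xorSum ((List.range 12).map fun k =>
      if point (12 + k) ∈ insert none (insert (some 0) h) then columnMasks.getD k 0 else 0) with hm
  have hs : insert none (insert (some 0) h) = ofMask m := eq_ofMask_of_mem_golayCode h4
  have hmem : m ∈ spanList columnMasks := xorSum_ite_mem_spanList
    (fun k => point (12 + k) ∈ insert none (insert (some 0) h)) (columnMasks.getD · 0)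
    (List.range 12)
  have hn : none ∈ ofMask m := by rw [← hs]; exact Finset.mem_insert_self _ _
  have h0 : some 0 ∈ ofMask m := by
    rw [← hs]; exact Finset.mem_insert_of_mem (Finset.mem_insert_self _ _)
  have hw : weight m = 8 := by
    rw [← card_ofMask, ← hs, Finset.card_insert_of_notMem h5, Finset.card_insert_of_notMem h2, h3]
  obtain ⟨n, hnc, hnm⟩ := List.mem_map.1
    (mem_disjointCycle_of_mem_spanList m hmem (mem_ofMask.1 hn) (mem_ofMask.1 h0) hw)
  refine ⟨n, hnc, ?_⟩
  rw [← hnm, ofMask_octadMask] at hs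
  obtain ⟨g1, g2, -, -⟩ := isHexad_ofMask_of_mem n (List.mem_append_left _ hnc)
  have g5 : none ∉ insert (some 0) (ofMask n) := by simpa using g1
  have e1 := congrArg (fun s => Finset.erase s none) hs
  simp only [Finset.erase_insert h5, Finset.erase_insert g5] at e1
  have e2 := congrArg (fun s => Finset.erase s (some 0)) e1
  simp only [Finset.erase_insert h2, Finset.erase_insert g2] at e2
  exact e2.symm

end Mathieu

/-! ### Explicit elements of `M₂₂` and its orbits on pairs of hexads. -/

namespace Mathieu

open scoped Pointwise

/-- The map of the points that is given by a list of numbers of points. -/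
def tableMap (t : List ℕ) (z : Point) : Point := point (t.getD (index z) 0)

/-- The mask of the preimage of a set of points. -/
def preimageMask (t : List ℕ) (m : ℕ) : ℕ :=
  Nat.ofBits fun i : Fin 24 => m.testBit (t.getD i 0)

theorem mem_ofMask_preimageMask {t : List ℕ} (ht : ∀ i < 24, t.getD i 0 < 24) (m : ℕ)
    (z : Point) : z ∈ ofMask (preimageMask t m) ↔ tableMap t z ∈ ofMask m := by
  rw [mem_ofMask, mem_ofMask, preimageMask, Nat.testBit_ofBits_lt _ _ (index_lt z), tableMap,
    index_point _ (ht _ (index_lt z))]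

/-- A test for the tables of permutations in `M₂₂`. -/
def IsTable (t : List ℕ) : Prop :=
  (∀ i < 24, t.getD i 0 < 24) ∧ (∀ i < 24, ∀ j < 24, t.getD i 0 = t.getD j 0 → i = j) ∧
    t.getD 23 0 = 23 ∧ t.getD 0 0 = 0 ∧
    ∀ m ∈ rowMasks, xorSum (rowCombination (preimageMask t m)) = preimageMask t m

instance (t : List ℕ) : Decidable (IsTable t) := by
  unfold IsTable; infer_instance

theorem isTable_of_mem : ∀ t ∈ [doubling, quintic, involution], IsTable t := by
  decide +kernel

theorem IsTable.bijective {t : List ℕ} (ht : IsTable t) : Function.Bijective (tableMap t) := by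
  apply Finite.injective_iff_bijective.1
  intro z w h
  have h1 := congrArg index h
  rw [tableMap, tableMap, index_point _ (ht.1 _ (index_lt z)),
    index_point _ (ht.1 _ (index_lt w))] at h1
  rw [← point_index z, ← point_index w, ht.2.1 _ (index_lt z) _ (index_lt w) h1]

/-- The permutation that is given by a table. -/
noncomputable def IsTable.perm {t : List ℕ} (ht : IsTable t) : Equiv.Perm Point :=
  Equiv.ofBijective (tableMap t) ht.bijective

theorem IsTable.inv_perm_smul_ofMask {t : List ℕ} (ht : IsTable t) (m : ℕ) :
    ht.perm⁻¹ • ofMask m = ofMask (preimageMask t m) := by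
  ext z
  rw [mem_ofMask_preimageMask ht.1, Finset.mem_inv_smul_finset_iff]
  rfl

theorem mem_M24_of_forall {σ : Equiv.Perm Point} (h : ∀ s ∈ golayCode, σ • s ∈ golayCode) :
    σ ∈ M24 := by
  rw [M24, MulAction.mem_stabilizer_iff]
  apply Set.eq_of_subset_of_ncard_le
  · rintro _ ⟨s, hs, rfl⟩
    exact h s hs
  · rw [Set.ncard_smul_set]
  · exact Set.toFinite _

theorem IsTable.perm_mem {t : List ℕ} (ht : IsTable t) : ht.perm ∈ M22 := by
  refine Subgroup.mem_inf.2 ⟨mem_M24_of_forall fun s hs => ?_, ?_⟩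
  · rw [mem_golayCode_iff] at hs ⊢
    intro m hm
    -- A check on the image of `s` is a check on `s` by the preimage, which `IsTable` makes a sum of
    -- row checks.
    have h1 : ht.perm • s ∩ ofMask m = ht.perm • (s ∩ ofMask (preimageMask t m)) := by
      rw [Finset.smul_finset_inter, ← ht.inv_perm_smul_ofMask, smul_inv_smul]
    rw [h1, Finset.card_smul_finset, ← ht.2.2.2.2 m hm]
    exact even_card_inter_xorSum fun n hn => hs n (rowCombination_subset _ n hn)
  · rw [mem_fixingSubgroup_iff]
    rintro z (rfl | rfl)
    · change point (t.getD 23 0) = none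
      rw [ht.2.2.1]
      rfl
    · change point (t.getD 0 0) = some 0
      rw [ht.2.2.2.1]
      rfl

/-- The masks that are reached from a list of masks by at most `n` of the given permutations. -/
def reach (ts : List (List ℕ)) : ℕ → List ℕ → List ℕ
  | 0, l => l
  | n + 1, l => reach ts n (l.flatMap (fun m => ts.map fun t => preimageMask t m) ∪ l)

theorem exists_smul_eq_of_mem_reach {H : Subgroup (Equiv.Perm Point)} {ts : List (List ℕ)}
    (ht : ∀ t ∈ ts, ∃ h : IsTable t, h.perm ∈ H) {s : Finset Point} (n : ℕ) {l : List ℕ}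
    (hl : ∀ m ∈ l, ∃ g ∈ H, g • s = ofMask m) :
    ∀ m ∈ reach ts n l, ∃ g ∈ H, g • s = ofMask m := by
  induction n generalizing l with
  | zero => exact hl
  | succ n ih =>
    refine ih fun m hm => ?_
    rcases List.mem_union_iff.1 hm with hm | hm
    · obtain ⟨m', hm', hm⟩ := List.mem_flatMap.1 hm
      obtain ⟨t, htt, rfl⟩ := List.mem_map.1 hm
      obtain ⟨h, hH⟩ := ht t htt
      obtain ⟨g, hg, hgs⟩ := hl m' hm'
      exact ⟨h.perm⁻¹ * g, mul_mem (inv_mem hH) hg, by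
        rw [mul_smul, hgs, h.inv_perm_smul_ofMask]⟩
    · exact hl m hm

/-- A hexad that is fixed by `quintic` and `involution`. -/
def baseHexad : ℕ := 958466

/-- An empty difference means that every hexad is reached, so `M₂₂` is transitive on hexads. The
next two statements treat in the same way the hexads that meet the base hexad in `0` or `2` points,
using only permutations that fix it. -/
theorem diff_reach_baseHexad :
    disjointCycle.diff (reach [doubling, quintic, involution] 7 [baseHexad]) = [] := by
  decide +kernel

theorem diff_reach_disjoint : (disjointCycle.filter fun m => weight (baseHexad &&& m) == 0).diff
    (reach [quintic, involution] 7 [4210904]) = [] := by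
  decide +kernel

theorem diff_reach_pair : (disjointCycle.filter fun m => weight (baseHexad &&& m) == 2).diff
    (reach [quintic, involution] 11 [2711560]) = [] := by
  decide +kernel

theorem IsHexad.smul {g : Equiv.Perm Point} (hg : g ∈ M22) {h : Finset Point} (hh : IsHexad h) :
    IsHexad (g • h) :=
  let x : Hexad := ⟨h, hh⟩
  ((⟨g, hg⟩ : M22) • x).2

theorem exists_smul_baseHexad_eq {h : Finset Point} (hh : IsHexad h) :
    ∃ g ∈ M22, g • ofMask baseHexad = h := by
  obtain ⟨m, hm, rfl⟩ := mem_map_disjointCycle hh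
  have hreach : m ∈ reach [doubling, quintic, involution] 7 [baseHexad] := by
    by_contra hr
    have := List.mem_diff_of_mem hm hr
    rw [diff_reach_baseHexad] at this
    exact List.not_mem_nil this
  refine exists_smul_eq_of_mem_reach (fun t ht => ⟨isTable_of_mem t ht, IsTable.perm_mem _⟩) 7
    (fun n hn => ⟨1, one_mem _, ?_⟩) m hreach
  rw [List.mem_singleton.1 hn, one_smul]

/-- The set `s` is a fixed representative, from which the stabilizer of the base hexad reaches all
hexads in the given relation to it. -/
theorem exists_forall_smul_eq {k : ℕ} (hk : k = 0 ∨ k = 2) :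
    ∃ s, ∀ h, IsHexad h → (ofMask baseHexad ∩ h).card = k →
      ∃ g ∈ M22, g • ofMask baseHexad = ofMask baseHexad ∧ g • s = h := by
  have hdiff : ∃ n c : ℕ, (disjointCycle.filter fun m => weight (baseHexad &&& m) == k).diff
      (reach [quintic, involution] n [c]) = [] := by
    rcases hk with rfl | rfl
    · exact ⟨_, _, diff_reach_disjoint⟩
    · exact ⟨_, _, diff_reach_pair⟩
  obtain ⟨n, c, hdiff⟩ := hdiff
  refine ⟨ofMask c, fun h hh hcard => ?_⟩
  obtain ⟨m, hm, rfl⟩ := mem_map_disjointCycle hh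
  rw [ofMask_inter, card_ofMask] at hcard
  have hreach : m ∈ reach [quintic, involution] n [c] := by
    by_contra hr
    have hm' : m ∈ disjointCycle.filter fun m => weight (baseHexad &&& m) == k :=
      List.mem_filter.2 ⟨hm, by simp [hcard]⟩
    have := List.mem_diff_of_mem hm' hr
    rw [hdiff] at this
    exact List.not_mem_nil this
  have hfix : ∀ t ∈ [quintic, involution], preimageMask t baseHexad = baseHexad := by
    decide +kernel
  obtain ⟨g, hg, hgm⟩ := exists_smul_eq_of_mem_reach
    (H := M22 ⊓ MulAction.stabilizer (Equiv.Perm Point) (ofMask baseHexad))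
    (fun t ht => ⟨isTable_of_mem t (List.mem_cons_of_mem _ ht), Subgroup.mem_inf.2
      ⟨IsTable.perm_mem _, by
        rw [← inv_mem_iff, MulAction.mem_stabilizer_iff, IsTable.inv_perm_smul_ofMask,
          hfix t ht]⟩⟩) n
    (fun n hn => ⟨1, one_mem _, by rw [List.mem_singleton.1 hn, one_smul]⟩) m hreach
  exact ⟨g, (Subgroup.mem_inf.1 hg).1, (Subgroup.mem_inf.1 hg).2, hgm⟩

/-- The group `M₂₂` is transitive on the pairs of hexads that meet in `k` points. -/
theorem exists_smul_pair_eq {k : ℕ} (hk : k = 0 ∨ k = 2) {x y a b : Finset Point}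
    (hx : IsHexad x) (hy : IsHexad y) (ha : IsHexad a) (hb : IsHexad b)
    (hxy : (x ∩ y).card = k) (hab : (a ∩ b).card = k) :
    ∃ g ∈ M22, g • x = a ∧ g • y = b := by
  obtain ⟨s, hs⟩ := exists_forall_smul_eq hk
  -- Every such pair is an image of the standard pair: carry the base hexad to `u`, then adjust
  -- inside its stabilizer.
  have key : ∀ u v, IsHexad u → IsHexad v → (u ∩ v).card = k →
      ∃ g ∈ M22, g • ofMask baseHexad = u ∧ g • s = v := by
    intro u v hu hv huv
    obtain ⟨g, hg, rfl⟩ := exists_smul_baseHexad_eq hu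
    obtain ⟨g', hg', h1, h2⟩ := hs (g⁻¹ • v) (hv.smul (inv_mem hg)) (by
      rw [← huv, ← Finset.card_smul_finset g, Finset.smul_finset_inter, smul_inv_smul])
    exact ⟨g * g', mul_mem hg hg', by rw [mul_smul, h1], by rw [mul_smul, h2, smul_inv_smul]⟩
  obtain ⟨g, hg, rfl, rfl⟩ := key x y hx hy hxy
  obtain ⟨g', hg', rfl, rfl⟩ := key a b ha hb hab
  exact ⟨g' * g⁻¹, mul_mem hg' (inv_mem hg), by rw [mul_smul, inv_smul_smul],
    by rw [mul_smul, inv_smul_smul]⟩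

/-- Two distinct hexads meet in no point or in two points. -/
theorem IsHexad.card_inter {x y : Finset Point} (hx : IsHexad x) (hy : IsHexad y) (hxy : x ≠ y) :
    (x ∩ y).card = 0 ∨ (x ∩ y).card = 2 := by
  obtain ⟨g, hg, rfl⟩ := exists_smul_baseHexad_eq hx
  -- By transitivity one hexad may be taken to be the base hexad, which leaves a check along the
  -- list.
  obtain ⟨m, hm, hmy⟩ := mem_map_disjointCycle (hy.smul (inv_mem hg))
  have h : ∀ m ∈ disjointCycle, m = baseHexad ∨ weight (baseHexad &&& m) = 0 ∨
      weight (baseHexad &&& m) = 2 := by decide +kernel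
  obtain rfl : g • ofMask m = y := by rw [hmy, smul_inv_smul]
  rw [← Finset.smul_finset_inter, Finset.card_smul_finset, ofMask_inter, card_ofMask]
  rcases h m hm with rfl | h
  · exact absurd rfl hxy
  · exact h

theorem nodup_map_ofMask {l : List ℕ} (hl : l.Nodup) (h : ∀ m ∈ l, m < 2 ^ 24) :
    (l.map ofMask).Nodup :=
  hl.map_on fun m hm n hn hmn => ofMask_injOn (h m hm) (h n hn) hmn

theorem card_hexad : Fintype.card Hexad = 77 := by
  have h1 := @Fintype.card_of_subtype _ IsHexad (disjointCycle.map ofMask).toFinset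
    (fun h => by
      rw [List.mem_toFinset, List.mem_map]
      constructor
      · rintro ⟨m, hm, rfl⟩
        exact isHexad_ofMask_of_mem m (List.mem_append_left _ hm)
      · exact mem_map_disjointCycle) instFintypeHexad
  rw [List.toFinset_card_of_nodup (nodup_map_ofMask (by decide +kernel) (by decide +kernel))] at h1
  exact h1

theorem exists_cycle {k : ℕ} (hk : k = 0 ∨ k = 2) :
    ∃ l : List ℕ, (∀ m ∈ l, IsHexad (ofMask m)) ∧ l.Nodup ∧ (∀ m ∈ l, m < 2 ^ 24) ∧
      (l ++ l.take 1).IsChain (fun m n => weight (m &&& n) = k) ∧ l.length = 77 := by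
  rcases hk with rfl | rfl
  · exact ⟨disjointCycle, fun m hm => isHexad_ofMask_of_mem m (List.mem_append_left _ hm),
      by decide +kernel⟩
  · exact ⟨pairCycle, fun m hm => isHexad_ofMask_of_mem m (List.mem_append_right _ hm),
      by decide +kernel⟩

theorem isHamiltonian_of_isGeneralizedOrbitalGraph {X : SimpleGraph Hexad}
    (hX : IsGeneralizedOrbitalGraph M22 X) (hne : X ≠ ⊥) : X.IsHamiltonian := by
  obtain ⟨x, y, hxy⟩ := SimpleGraph.ne_bot_iff_exists_adj.1 hne
  have hxy' : x.1 ≠ y.1 := fun h => X.irrefl ((Subtype.ext h : x = y) ▸ hxy)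
  have hk := IsHexad.card_inter x.2 y.2 hxy'
  obtain ⟨l, hl, hn, hlt, hc, hlen⟩ := exists_cycle hk
  have hc' : (l.map ofMask ++ (l.map ofMask).take 1).IsChain
      (fun a b => (a ∩ b).card = (x.1 ∩ y.1).card) := by
    rw [← List.map_take, ← List.map_append, List.isChain_map]
    refine hc.imp fun m n h => ?_
    rw [ofMask_inter, card_ofMask, h]
  refine SimpleGraph.isHamiltonian_of_isChain (val := fun h : Hexad => h.1) (fun a b hab => ?_) ?_
    (nodup_map_ofMask hn hlt) hc' (by rw [List.length_map, hlen]; norm_num)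
    (by rw [List.length_map, hlen, card_hexad])
  · obtain ⟨g, hg, hgx, hgy⟩ := exists_smul_pair_eq hk x.2 y.2 a.2 b.2 rfl hab
    have h := hX.adj_smul hxy ⟨g, hg⟩
    convert h using 1
    · exact Subtype.ext hgx.symm
    · exact Subtype.ext hgy.symm
  · intro a ha
    obtain ⟨m, hm, rfl⟩ := List.mem_map.1 ha
    exact ⟨⟨ofMask m, hl m hm⟩, rfl⟩

end Mathieu

theorem proposition5p1 :
    -- orthogonal groups of plus type, with `(p, q) = (2^d - 1, 2^(d-1) + 1)`
    (∀ d : ℕ, (2 ^ d - 1).Prime → (2 ^ (d - 1) + 1).Prime → 2 ^ (d - 1) + 1 < 2 ^ d - 1 →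
      ∀ X : SimpleGraph (SingularOneSpace (OrthSpace.plusForm d)),
        IsGeneralizedOrbitalGraph (POmega (OrthSpace.plusForm d)) X → X ≠ ⊥ →
          X.IsHamiltonian) ∧
    -- orthogonal groups of minus type, with `(p, q) = (2^d + 1, 2^(d-1) - 1)`
    (∀ d : ℕ, (2 ^ d + 1).Prime → (2 ^ (d - 1) - 1).Prime →
      ∀ X : SimpleGraph (SingularOneSpace (OrthSpace.minusForm d)),
        IsGeneralizedOrbitalGraph (POmega (OrthSpace.minusForm d)) X → X ≠ ⊥ →
          X.IsHamiltonian) ∧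
    -- the Mathieu group of degree 22 in its action of degree 77
    (∀ X : SimpleGraph Mathieu.Hexad,
      IsGeneralizedOrbitalGraph Mathieu.M22 X → X ≠ ⊥ → X.IsHamiltonian) ∧
    -- the alternating group of degree 7 on triples
    (∀ X : SimpleGraph (Set.powersetCard (Fin 7) 3),
      IsGeneralizedOrbitalGraph (alternatingGroup (Fin 7)) X → X ≠ ⊥ → X.IsHamiltonian) := by
  refine ⟨fun d _ _ hd X hX hne => ?_, fun d hp hq X hX hne => ?_, fun X hX hne => ?_,
    fun X hX hne => ?_⟩
  · exact OrthSpace.isHamiltonian_of_isGeneralizedOrbitalGraph_plusForm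
      (OrthSpace.three_le_of_lt hd) hX hne
  · exact OrthSpace.isHamiltonian_of_isGeneralizedOrbitalGraph_minusForm
      (OrthSpace.four_le_of_prime hp hq) hX hne
  · exact Mathieu.isHamiltonian_of_isGeneralizedOrbitalGraph hX hne
  · exact Triple.isHamiltonian_of_isGeneralizedOrbitalGraph hX hne
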